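/- A \emph{Finsler PL space} is a length metric space $X$ (distances between different components may be infinite) glued from a family of convex polyhedral sets (finite intersections of closed half-spaces, possibly unbounded) in finite-dimensional normed spaces whose norms are strictly convex and $C^1$ away from the origin. Here the projection to $X$ is injective on the relative interior of every face of every cell (faces of all dimensions, the cell itself included); whenever two points of cells are identified, the faces containing them in their relative interiors are identified along an affine isometry; every point of $X$ belongs to finitely many cells; and the distance between two points is the infimum of the lengths of broken lines (finite chains of affine segments, each contained in one cell) joining them. A curve $\gamma\colon[a,b]\to X$ is a \emph{geodesic} if it is continuous and every $t_0\in[a,b]$ has a neighborhood in $[a,b]$ on which $\gamma$ is a shortest path, i.e. has minimal length among all curves with the same endpoints. \textbf{Theorem.} Let $X$ be a Finsler PL space and let $\gamma\colon[a,b]\to X$ be a geodesic which makes no stops, that is, $\gamma$ is either constant on $[a,b]$ or not constant on any nondegenerate subinterval (e.g. $\gamma$ has constant speed). Then $\gamma$ is stable: there is $\varepsilon>0$ such that every curve $\gamma_1\colon[a,b]\to X$ with $\gamma_1(a)=\gamma(a)$, $\gamma_1(b)=\gamma(b)$ and $d(\gamma_1(t),\gamma(t))<\varepsilon$ for all $t\in[a,b]$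 satisfies $\mathrm{length}(\gamma_1)>\mathrm{length}(\gamma)$, unless $\gamma_1$ is a reparameterization of $\gamma$, i.e. $\gamma_1=\gamma\circ\varphi$ for a continuous nondecreasing $\varphi\colon[a,b]\to[a,b]$ with $\varphi(a)=a$ and $\varphi(b)=b$. -/

import Mathlib

open Set Topology
open scoped ENNReal

universe u v w

namespace FinslerPL

/-- A convex polyhedral set: the intersection of finitely many closed half-spaces
(not necessarily bounded, not necessarily of full dimension). -/
def IsPolyhedral {V : Type w} [AddCommGroup V] [Module ℝ V] (P : Set V) : Prop :=
  ∃ (n : ℕ) (f : Fin n → Module.Dual ℝ V) (c : Fin n → ℝ), P = {x | ∀ k, f k x ≤ c k}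

/-- A locally finite complex on the set `X`, glued from convex polyhedral sets `cell i` in
finite-dimensional normed spaces `V i` with `C¹` (away from the origin), strictly convex norms.
The set `X` is the quotient of the disjoint union of the cells by the map whose restriction to the
`i`-th cell is `proj i` (the values of `proj i` outside `cell i` play no role).
The faces of a cell are its exposed faces, the cell itself (cut out by the zero functional)
included; each point lies in the relative interior of exactly one face of its cell. -/
structure Complex (X : Type u) where
  /-- The index set of the cells. -/
  ι : Type v
  /-- The ambient normed space of each cell. -/
  V : ι → Type w
  [normedAddCommGroup : ∀ i, NormedAddCommGroup (V i)]
  [normedSpace : ∀ i, NormedSpace ℝ (V i)]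
  [finiteDimensional : ∀ i, FiniteDimensional ℝ (V i)]
  [strictConvexSpace : ∀ i, StrictConvexSpace ℝ (V i)]
  contDiffOn_norm : ∀ i, ContDiffOn ℝ 1 (fun x : V i => ‖x‖) {0}ᶜ
  /-- The convex polyhedral sets that are glued together. -/
  cell : ∀ i, Set (V i)
  isPolyhedral_cell : ∀ i, IsPolyhedral (cell i)
  /-- The projection of each cell to the glued space. -/
  proj : ∀ i, V i → X
  exists_proj_eq : ∀ x : X, ∃ i, ∃ p ∈ cell i, proj i p = x
  /-- No two points in the relative interior of one face are identified. -/
  injOn_proj : ∀ (i : ι) (F : Set (V i)), IsExposed ℝ (cell i) F →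
    InjOn (proj i) (intrinsicInterior ℝ F)
  /-- If two points are identified, then the faces that contain them in their relative interiors
  are identified along an affine isometry. -/
  exists_isometry : ∀ (i j : ι) (F : Set (V i)) (G : Set (V j)),
    IsExposed ℝ (cell i) F → IsExposed ℝ (cell j) G →
    ∀ p ∈ intrinsicInterior ℝ F, ∀ q ∈ intrinsicInterior ℝ G, proj i p = proj j q →
      ∃ h : V i →ᵃ[ℝ] V j, h '' F = G ∧
        (∀ y ∈ F, ∀ z ∈ F, dist (h y) (h z) = dist y z) ∧
        ∀ y ∈ F, proj j (h y) = proj i y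
  /-- Local finiteness: each point belongs to finitely many cells
  (and hence to finitely many faces). -/
  locallyFinite : ∀ x : X, {i | x ∈ proj i '' cell i}.Finite

attribute [instance] Complex.normedAddCommGroup Complex.normedSpace
  Complex.finiteDimensional Complex.strictConvexSpace

/-- The least length of an affine segment that lies in one cell and joins `x` to `y`
(`∞` if no cell contains both points). -/
noncomputable def Complex.segmentDist {X : Type u} (K : Complex.{u, v, w} X) (x y : X) : ℝ≥0∞ :=
  ⨅ (i : K.ι) (p : K.V i) (q : K.V i) (_ : p ∈ K.cell i) (_ : q ∈ K.cell i)
    (_ : K.proj i p = x) (_ : K.proj i q = y), edist p q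

/-- The length distance of the complex: the infimum of the lengths of the broken lines
that join `x` to `y` (`∞` if there are none). -/
noncomputable def Complex.lengthDist {X : Type u} (K : Complex.{u, v, w} X) (x y : X) : ℝ≥0∞ :=
  ⨅ (n : ℕ) (z : ℕ → X) (_ : z 0 = x) (_ : z n = y),
    ∑ k ∈ Finset.range n, K.segmentDist (z k) (z (k + 1))

/-- The structure of a Finsler PL space on a metric space `X`: a decomposition into
polyhedral cells such that the metric of `X` is the length metric of the complex.
Distances between different connected components are infinite. -/
structure Space (X : Type u) [EMetricSpace X] extends Complex.{u, v, w} X where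
  edist_eq : ∀ x y : X, edist x y = toComplex.lengthDist x y

section Curves

variable {X : Type u} [EMetricSpace X]

/-- The length of the curve `γ : [a, b] → X`. -/
noncomputable def len (γ : ℝ → X) (a b : ℝ) : ℝ≥0∞ := eVariationOn γ (Icc a b)

/-- `γ` restricted to `[s, t]` is a shortest path. -/
def IsShortestPath (γ : ℝ → X) (s t : ℝ) : Prop :=
  ContinuousOn γ (Icc s t) ∧
    ∀ (c d : ℝ) (σ : ℝ → X), c ≤ d → ContinuousOn σ (Icc c d) → σ c = γ s → σ d = γ t →
      len γ s t ≤ len σ c d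

/-- `γ : [a, b] → X` is a geodesic, that is, a locally minimizing curve: each point of the domain
has a neighbourhood in the domain on which `γ` is a shortest path. -/
def IsGeodesic (γ : ℝ → X) (a b : ℝ) : Prop :=
  ContinuousOn γ (Icc a b) ∧
    ∀ t₀ ∈ Icc a b, ∃ s t : ℝ, s ≤ t ∧ Icc s t ⊆ Icc a b ∧ Icc s t ∈ 𝓝[Icc a b] t₀ ∧
      IsShortestPath γ s t

/-- `γ : [a, b] → X` makes no stops: unless it is a constant curve, it is not constant on any
nondegenerate interval. Every curve of constant speed has this property. -/
def NoStops (γ : ℝ → X) (a b : ℝ) : Prop :=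
  (∀ t ∈ Icc a b, γ t = γ a) ∨
    ∀ s t : ℝ, a ≤ s → s < t → t ≤ b → ∃ r ∈ Icc s t, γ r ≠ γ s

/-- `γ₁ : [a, b] → X` is a reparameterization of `γ : [a, b] → X`. -/
def IsReparam (γ₁ γ : ℝ → X) (a b : ℝ) : Prop :=
  ∃ φ : ℝ → ℝ, ContinuousOn φ (Icc a b) ∧ MonotoneOn φ (Icc a b) ∧ φ a = a ∧ φ b = b ∧
    ∀ t ∈ Icc a b, γ₁ t = γ (φ t)

/-- `γ : [a, b] → X` is stable: it is strictly shorter than every uniformly close curve with the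
same endpoints that is not a reparameterization of it. -/
def IsStable (γ : ℝ → X) (a b : ℝ) : Prop :=
  ∃ ε : ℝ≥0∞, 0 < ε ∧ ∀ γ₁ : ℝ → X, ContinuousOn γ₁ (Icc a b) → γ₁ a = γ a → γ₁ b = γ b →
    (∀ t ∈ Icc a b, edist (γ₁ t) (γ t) < ε) → ¬ IsReparam γ₁ γ a b →
      len γ a b < len γ₁ a b

end Curves

end FinslerPL

/-! In arc length parametrization (`isStable_of_noStops`) the geodesic `γ` lives on `[0, L]` and is
isometric near every parameter. Near a point `x` the space is a cone, and homotheties towards `x`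
multiply distances by at most their ratio (`exists_apex`). Strict convexity makes shortest paths
from `x` radial (`eq_proj_lineMap_of_additive`), so `γ` is straight, with a direction `u`, at all
interior parameters near `c` other than `c` itself (`exists_isRegularAt`).

The core is a calibration. If `y` lies over `γ t`, a point `q` near `y` in the same cell has offset
`v`, the differential of the norm at `u` applied to `q - y`. For `s < c ≤ t` close to `c`, and
points `z`, `z'` near `γ s`, `γ t` with offsets `v`, `v'`, the inequality `(t + v') - (s + v) ≤ d(z,
z')` holds exactly, without error term (`le_edist_of_hasOffset`). Indeed, shrink `z` and `z'`
towards `γ c` by a factor `l`. A path from a point of `γ` before `γ c` through both shrunk points to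
a point of `γ` after `γ c` is no shorter than `γ`. To first order in `l`, its outer pieces are
governed by the differential of the norm, and its middle piece is at most `l * d(z, z')`. Dividing
by `l` gives the inequality. The bounds telescope, and the offset vanishes at both ends, so a nearby
curve has length at least `L`.

In the equality case every piece attains its bound. A curve already on `γ` then stays on `γ` up to
`γ c`, because shortest paths do not branch at regular points (`eq_of_additive_of_isRegularAt`).
Past `γ c`, which need not be regular, it stays on `γ` because the norm agrees with its differential
at `u` only on nonnegative multiples of `u` (`eq_of_len_le_after`). `IsStableUpTo` joins bound and
rigidity, and continuous induction carries it from `0` to `L`. -/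

namespace FinslerPL

/-! ### Faces of polyhedral sets -/

section Face

variable {V : Type w}

/-- The smallest face of `P` that contains `p`: the points `y` of `P` such that the segment from
`y` to `p` can be prolonged beyond `p` inside `P`. -/
def face [AddCommGroup V] [Module ℝ V] (P : Set V) (p : V) : Set V :=
  {y ∈ P | ∃ ε : ℝ, 0 < ε ∧ p + ε • (p - y) ∈ P}

lemma face_subset [AddCommGroup V] [Module ℝ V] (P : Set V) (p : V) : face P p ⊆ P :=
  fun _ h => h.1

lemma self_mem_face [AddCommGroup V] [Module ℝ V] {P : Set V} {p : V} (hp : p ∈ P) :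
    p ∈ face P p := ⟨hp, 1, one_pos, by simpa using hp⟩

lemma IsPolyhedral.convex [AddCommGroup V] [Module ℝ V] {P : Set V} (hP : IsPolyhedral P) :
    Convex ℝ P := by
  obtain ⟨n, f, c, rfl⟩ := hP
  rw [ofPred_forall]
  exact convex_iInter fun k => convex_halfSpace_le (f k).isLinear (c k)

variable [NormedAddCommGroup V] [NormedSpace ℝ V] [FiniteDimensional ℝ V]

/-- Prolonging the segment from `y` past `p` violates a constraint active at `p` unless `y` is tight
there too; inactive constraints leave room for a small prolongation. -/
lemma mem_face_iff {n : ℕ} (f : Fin n → Module.Dual ℝ V) (c : Fin n → ℝ) {p y : V}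
    (hp : ∀ k, f k p ≤ c k) :
    y ∈ face {x | ∀ k, f k x ≤ c k} p ↔
      (∀ k, f k y ≤ c k) ∧ ∀ k, f k p = c k → f k y = c k := by
  constructor
  · rintro ⟨hy, ε, hε, h⟩
    refine ⟨hy, fun k hk => le_antisymm (hy k) ?_⟩
    have := h k
    simp only [map_add, map_smul, map_sub, smul_eq_mul, hk] at this
    nlinarith
  · rintro ⟨hy, h⟩
    refine ⟨hy, ?_⟩
    have : ∀ᶠ ε in 𝓝[>] (0 : ℝ), ∀ k, f k (p + ε • (p - y)) ≤ c k := by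
      rw [Filter.eventually_all]
      intro k
      rcases (hp k).eq_or_lt with hk | hk
      · filter_upwards with ε
        simp [hk, h k hk]
      · have hc : Continuous fun ε : ℝ => f k (p + ε • (p - y)) :=
          (f k).continuous_of_finiteDimensional.comp (by fun_prop)
        have : ∀ᶠ ε in 𝓝 (0 : ℝ), f k (p + ε • (p - y)) < c k :=
          hc.continuousAt.eventually_lt continuousAt_const (by simpa using hk)
        exact (this.filter_mono nhdsWithin_le_nhds).mono fun ε h => h.le
    obtain ⟨ε, h1, h2⟩ := (this.and self_mem_nhdsWithin).exists
    exact ⟨ε, h2, h1⟩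

variable {P : Set V}

lemma IsPolyhedral.face (hP : IsPolyhedral P) {p : V} (hp : p ∈ P) :
    IsPolyhedral (face P p) := by
  classical
  obtain ⟨n, f, c, rfl⟩ := hP
  refine ⟨n + n, Fin.append f fun k => if f k p = c k then -f k else 0,
    Fin.append c fun k => if f k p = c k then -c k else 0, ?_⟩
  ext y
  rw [mem_face_iff f c hp, mem_ofPred_eq, Fin.forall_fin_add]
  simp only [Fin.append_left, Fin.append_right]
  refine and_congr_right fun hy => forall_congr' fun k => ?_
  split_ifs with h
  · simp [h, le_antisymm_iff, hy k]
  · simp [h]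

/-- The sum of the constraints active at `p` exposes the face: it is maximal exactly where each
summand is. -/
lemma IsPolyhedral.isExposed_face (hP : IsPolyhedral P) {p : V} (hp : p ∈ P) :
    IsExposed ℝ P (FinslerPL.face P p) := by
  classical
  obtain ⟨n, f, c, rfl⟩ := hP
  intro _
  set A := Finset.univ.filter fun k => f k p = c k
  refine ⟨LinearMap.toContinuousLinearMap (∑ k ∈ A, f k), ?_⟩
  ext y
  rw [mem_face_iff f c hp]
  simp only [mem_ofPred_eq, LinearMap.coe_toContinuousLinearMap', LinearMap.sum_apply]
  refine and_congr_right fun hy => ⟨fun h z hz => ?_, fun h k hk => ?_⟩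
  · refine Finset.sum_le_sum fun k hk => ?_
    rw [h k (by simpa [A] using hk)]
    exact hz k
  · have h1 : ∀ k ∈ A, f k y ≤ f k p := fun k hk => by
      rw [(by simpa [A] using hk : f k p = c k)]; exact hy k
    have := (Finset.sum_eq_sum_iff_of_le h1).1
      (le_antisymm (Finset.sum_le_sum h1) (h p hp)) k (by simpa [A] using hk)
    rw [this, hk]

/-- Active constraints are equalities on the affine span of the face, and inactive ones stay strict
near `p`. -/
lemma IsPolyhedral.mem_intrinsicInterior_face (hP : IsPolyhedral P) {p : V} (hp : p ∈ P) :
    p ∈ intrinsicInterior ℝ (FinslerPL.face P p) := by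
  have hself := self_mem_face hp
  obtain ⟨n, f, c, rfl⟩ := hP
  rw [mem_intrinsicInterior]
  refine ⟨⟨p, subset_affineSpan ℝ _ hself⟩, ?_, rfl⟩
  rw [mem_interior_iff_mem_nhds]
  have : ∀ᶠ y in 𝓝 p, ∀ k, f k p < c k → f k y < c k := by
    rw [Filter.eventually_all]
    intro k
    by_cases hk : f k p < c k
    · filter_upwards [(f k).continuous_of_finiteDimensional.continuousAt.eventually_lt
        continuousAt_const hk] with y hy _ using hy
    · filter_upwards with y h using absurd h hk
  have h2 := (continuous_subtype_val.tendsto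
    (⟨p, subset_affineSpan ℝ _ hself⟩ : affineSpan ℝ (FinslerPL.face _ p))).eventually this
  filter_upwards [h2] with y hy
  have key : ∀ k, f k p = c k → f k y = c k := by
    intro k hk
    have hle : affineSpan ℝ (FinslerPL.face {x | ∀ k, f k x ≤ c k} p) ≤
        (AffineSubspace.mk' (c k) ⊥).comap (f k).toAffineMap := by
      rw [affineSpan_le]
      intro z hz
      have := ((mem_face_iff f c hp).1 hz).2 k hk
      simp [this]
    have := hle y.2
    simpa [sub_eq_zero] using this
  rw [mem_preimage, mem_face_iff f c hp]
  refine ⟨fun k => ?_, key⟩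
  rcases (hp k).eq_or_lt with hk | hk
  · exact (key k hk).le
  · exact (hy k hk).le

lemma IsPolyhedral.face_eq (hP : IsPolyhedral P) {p q : V} (hq : q ∈ FinslerPL.face P p)
    (hp : p ∈ FinslerPL.face P q) : FinslerPL.face P q = FinslerPL.face P p := by
  obtain ⟨n, f, c, rfl⟩ := hP
  ext y
  rw [mem_face_iff f c hp.1, mem_face_iff f c hq.1]
  have h1 := ((mem_face_iff f c hp.1).1 hq).2
  have h2 := ((mem_face_iff f c hq.1).1 hp).2
  exact and_congr_right fun _ => forall_congr' fun k =>
    ⟨fun h h' => h (h1 k h'), fun h h' => h (h2 k h')⟩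

lemma IsPolyhedral.eventually_mem_face (hP : IsPolyhedral P) {p : V} (hp : p ∈ P) :
    ∀ᶠ q in 𝓝 p, q ∈ P → p ∈ FinslerPL.face P q := by
  obtain ⟨n, f, c, rfl⟩ := hP
  have : ∀ᶠ y in 𝓝 p, ∀ k, f k p < c k → f k y < c k := by
    rw [Filter.eventually_all]
    intro k
    by_cases hk : f k p < c k
    · filter_upwards [(f k).continuous_of_finiteDimensional.continuousAt.eventually_lt
        continuousAt_const hk] with y hy _ using hy
    · filter_upwards with y h using absurd h hk
  filter_upwards [this] with q hq hqP
  rw [mem_face_iff f c hqP]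
  exact ⟨hp, fun k hk => by_contra fun h => (hq k ((hp k).lt_of_ne h)).ne hk⟩

lemma IsPolyhedral.finite_faces (hP : IsPolyhedral P) : (FinslerPL.face P '' P).Finite := by
  classical
  obtain ⟨n, f, c, rfl⟩ := hP
  refine (Set.finite_range fun A : Finset (Fin n) =>
    {y | (∀ k, f k y ≤ c k) ∧ ∀ k ∈ A, f k y = c k}).subset ?_
  rintro _ ⟨p, hp, rfl⟩
  refine ⟨Finset.univ.filter fun k => f k p = c k, ?_⟩
  ext y
  rw [mem_face_iff f c hp]
  simp

end Face

/-! ### Gluing and radial structure -/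

namespace Complex

variable {X : Type u} (K : Complex.{u, v, w} X)

lemma injOn_face {i : K.ι} {p q : K.V i} (hq : q ∈ face (K.cell i) p)
    (hp : p ∈ face (K.cell i) q) (h : K.proj i p = K.proj i q) : p = q := by
  have hP := K.isPolyhedral_cell i
  refine K.injOn_proj i _ (hP.isExposed_face hp.1) (hP.mem_intrinsicInterior_face hp.1) ?_ h
  rw [← hP.face_eq hq hp]
  exact hP.mem_intrinsicInterior_face hq.1

/-- The gluing isometry is not assumed to send `p` to `q`. However, `g p` and `q` have the same
minimal face and the same projection, so injectivity on relative interiors identifies them. -/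
lemma exists_glue {i j : K.ι} {p : K.V i} {q : K.V j} (hp : p ∈ K.cell i) (hq : q ∈ K.cell j)
    (h : K.proj i p = K.proj j q) :
    ∃ g : K.V i →ᵃ[ℝ] K.V j, g p = q ∧ ∀ y ∈ face (K.cell i) p,
      g y ∈ face (K.cell j) q ∧ dist (g y) q = dist y p ∧ K.proj j (g y) = K.proj i y := by
  have hP := K.isPolyhedral_cell i
  have hQ := K.isPolyhedral_cell j
  obtain ⟨g, h1, h2, h3⟩ := K.exists_isometry i j _ _ (hP.isExposed_face hp)
    (hQ.isExposed_face hq) p (hP.mem_intrinsicInterior_face hp) q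
    (hQ.mem_intrinsicInterior_face hq) h
  have hpp := self_mem_face hp
  have hgp : g p ∈ face (K.cell j) q := h1 ▸ mem_image_of_mem g hpp
  have hqg : q ∈ face (K.cell j) (g p) := by
    refine ⟨hq, ?_⟩
    -- Writing `q = g y`, the image under `g` of a prolongation from `y` past `p` prolongs the
    -- segment from `q` past `g p`.
    obtain ⟨y, hy, hyq⟩ : q ∈ g '' face (K.cell i) p := h1 ▸ self_mem_face hq
    obtain ⟨ε, hε, hz⟩ := hy.2
    refine ⟨ε, hε, ?_⟩
    have hz' : p + ε • (p - y) ∈ face (K.cell i) p := by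
      refine ⟨hz, ε⁻¹, by positivity, ?_⟩
      simpa [smul_smul, inv_mul_cancel₀ hε.ne'] using hy.1
    have : g (p + ε • (p - y)) = g p + ε • (g p - q) := by
      rw [← hyq, add_comm p, ← vadd_eq_add, g.map_vadd, map_smul, ← vsub_eq_sub p y,
        g.linearMap_vsub, vadd_eq_add, vsub_eq_sub, add_comm]
    rw [← this]
    exact face_subset _ _ (h1 ▸ mem_image_of_mem g hz')
  have hgpq : g p = q := K.injOn_face hqg hgp ((h3 p hpp).trans h)
  exact ⟨g, hgpq, fun y hy => ⟨h1 ▸ mem_image_of_mem g hy, hgpq ▸ h2 y hy p hpp, h3 y hy⟩⟩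

/-- Within distance `r` of `x` every cell is a cone with apex over `x`. -/
structure IsConeRadius (x : X) (r : ℝ) : Prop where
  pos : 0 < r
  mem_face : ∀ {i : K.ι} {p q : K.V i}, p ∈ K.cell i → K.proj i p = x → q ∈ K.cell i →
    dist q p < r → p ∈ face (K.cell i) q
  unique : ∀ {i : K.ι} {p p' : K.V i}, p ∈ K.cell i → K.proj i p = x → p' ∈ K.cell i →
    K.proj i p' = x → dist p p' < 2 * r → p = p'

lemma finite_fiber (x : X) : {a : Σ i, K.V i | a.2 ∈ K.cell a.1 ∧ K.proj a.1 a.2 = x}.Finite := by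
  have h : ∀ i, {p | p ∈ K.cell i ∧ K.proj i p = x}.Finite := fun i => by
    refine Set.Finite.of_finite_image ((K.isPolyhedral_cell i).finite_faces.subset
      (image_mono fun p hp => hp.1)) ?_
    intro p hp q hq hpq
    exact K.injOn_face (hpq ▸ self_mem_face hq.1) (hpq ▸ self_mem_face hp.1) (hp.2.trans hq.2.symm)
  refine ((K.locallyFinite x).biUnion fun i _ => (h i).image (Sigma.mk i)).subset ?_
  rintro ⟨i, p⟩ ⟨hp, hx⟩
  simp only [mem_iUnion]
  exact ⟨i, ⟨p, hp, hx⟩, p, ⟨hp, hx⟩, rfl⟩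

/-- There are only finitely many lifts of `x`, so the local cone radii and the separations of
distinct lifts in one cell have a common positive bound. -/
lemma exists_isConeRadius (x : X) : ∃ r, K.IsConeRadius x r := by
  have hfin := K.finite_fiber x
  have h1 : ∀ᶠ r in 𝓝[>] (0 : ℝ), ∀ a ∈ {a : Σ i, K.V i | a.2 ∈ K.cell a.1 ∧ K.proj a.1 a.2 = x},
      ∀ q ∈ K.cell a.1, dist q a.2 < r → a.2 ∈ face (K.cell a.1) q := by
    rw [hfin.eventually_all]
    rintro ⟨i, p⟩ ⟨hp, hx⟩
    obtain ⟨ε, hε, h⟩ := Metric.eventually_nhds_iff.1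
      ((K.isPolyhedral_cell i).eventually_mem_face hp)
    filter_upwards [Ioo_mem_nhdsGT hε] with r hr q hq hd using h (hd.trans hr.2) hq
  have h2 : ∀ᶠ r in 𝓝[>] (0 : ℝ), ∀ a ∈ {a : Σ i, K.V i | a.2 ∈ K.cell a.1 ∧ K.proj a.1 a.2 = x},
      ∀ b ∈ {a : Σ i, K.V i | a.2 ∈ K.cell a.1 ∧ K.proj a.1 a.2 = x},
      ∀ h : a.1 = b.1, dist (h ▸ a.2) b.2 < 2 * r → h ▸ a.2 = b.2 := by
    rw [hfin.eventually_all]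
    rintro ⟨i, p⟩ ⟨hp, hx⟩
    rw [hfin.eventually_all]
    rintro ⟨j, q⟩ ⟨hq, hx'⟩
    by_cases hij : i = j
    · subst hij
      by_cases hpq : p = q
      · filter_upwards with r _ _ using hpq
      · have : 0 < dist p q / 2 := by have := dist_pos.2 hpq; positivity
        filter_upwards [Ioo_mem_nhdsGT this] with r hr _ hd
        have := hr.2
        exfalso
        linarith
    · filter_upwards with r h using absurd h hij
  obtain ⟨r, ⟨h1, h2⟩, h3⟩ := ((h1.and h2).and self_mem_nhdsWithin).exists
  exact ⟨r, h3, fun {i p q} hp hx hq hd => h1 ⟨i, p⟩ ⟨hp, hx⟩ q hq hd,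
    fun {i p p'} hp hx hp' hx' hd => h2 ⟨i, p⟩ ⟨hp, hx⟩ ⟨i, p'⟩ ⟨hp', hx'⟩ rfl hd⟩

variable {K} {x : X} {r : ℝ}

lemma IsConeRadius.eq_of_dist_lt (h : K.IsConeRadius x r) {i : K.ι} {p p' q : K.V i}
    (hp : p ∈ K.cell i) (hx : K.proj i p = x) (hp' : p' ∈ K.cell i) (hx' : K.proj i p' = x)
    (hd : dist q p < r) (hd' : dist q p' < r) : p = p' :=
  h.unique hp hx hp' hx' (by
    have := dist_triangle_left p p' q
    linarith)

lemma lineMap_mem_cell {i : K.ι} {p q : K.V i} (hp : p ∈ K.cell i) (hq : q ∈ K.cell i) {l : ℝ}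
    (hl : l ∈ Icc (0 : ℝ) 1) : AffineMap.lineMap p q l ∈ K.cell i :=
  (K.isPolyhedral_cell i).convex.lineMap_mem hp hq hl

/-- The face of `q` contains `p`, hence the whole radius from `p` to `q`; the isometry gluing the
faces of `q` and `q'` carries this radius to the other cell. -/
lemma IsConeRadius.transfer (h : K.IsConeRadius x r) {i j : K.ι} {p q : K.V i} {q' : K.V j}
    (hp : p ∈ K.cell i) (hx : K.proj i p = x) (hq : q ∈ K.cell i) (hd : dist q p < r)
    (hq' : q' ∈ K.cell j) (hqq : K.proj i q = K.proj j q') :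
    ∃ p' ∈ K.cell j, K.proj j p' = x ∧ dist q' p' = dist q p ∧ ∀ l ∈ Icc (0 : ℝ) 1,
      K.proj j (AffineMap.lineMap p' q' l) = K.proj i (AffineMap.lineMap p q l) := by
  obtain ⟨g, hg, hy⟩ := K.exists_glue hq hq' hqq
  have hpf := h.mem_face hp hx hq hd
  obtain ⟨h1, h2, h3⟩ := hy p hpf
  refine ⟨g p, h1.1, h3.trans hx, by rw [dist_comm, h2, dist_comm], fun l hl => ?_⟩
  rw [← hg, ← AffineMap.apply_lineMap]
  refine (hy _ ?_).2.2
  exact ((K.isPolyhedral_cell i).face hq).convex.lineMap_mem hpf (self_mem_face hq) hl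

end Complex

lemma dist_lineMap_same_left {V : Type w} [NormedAddCommGroup V] [NormedSpace ℝ V] (p a b : V)
    {l : ℝ} (hl : 0 ≤ l) :
    dist (AffineMap.lineMap p a l) (AffineMap.lineMap p b l) = l * dist a b := by
  simp only [AffineMap.lineMap_apply, vsub_eq_sub, vadd_eq_add, dist_add_right]
  rw [dist_smul₀, dist_sub_right, Real.norm_of_nonneg hl]

namespace Complex

variable {X : Type u} {K : Complex.{u, v, w} X} {x : X} {r : ℝ}

lemma segmentDist_le {i : K.ι} {p q : K.V i} (hp : p ∈ K.cell i) (hq : q ∈ K.cell i) :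
    K.segmentDist (K.proj i p) (K.proj i q) ≤ edist p q := by
  unfold segmentDist
  exact iInf_le_of_le i <| iInf_le_of_le p <| iInf_le_of_le q <| iInf_le_of_le hp <|
    iInf_le_of_le hq <| iInf_le_of_le rfl <| iInf_le_of_le rfl le_rfl

lemma segmentDist_lt_iff {y z : X} {L : ℝ≥0∞} : K.segmentDist y z < L ↔
    ∃ i, ∃ p ∈ K.cell i, ∃ q ∈ K.cell i, K.proj i p = y ∧ K.proj i q = z ∧ edist p q < L := by
  simp only [segmentDist, iInf_lt_iff, exists_prop]
  constructor
  · rintro ⟨i, p, q, hp, hq, h1, h2, h3⟩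
    exact ⟨i, p, hp, q, hq, h1, h2, h3⟩
  · rintro ⟨i, p, hp, q, hq, h1, h2, h3⟩
    exact ⟨i, p, q, hp, hq, h1, h2, h3⟩

lemma lengthDist_lt_iff {y z : X} {L : ℝ≥0∞} : K.lengthDist y z < L ↔
    ∃ (n : ℕ) (c : ℕ → X), c 0 = y ∧ c n = z ∧
      ∑ k ∈ Finset.range n, K.segmentDist (c k) (c (k + 1)) < L := by
  simp only [lengthDist, iInf_lt_iff, exists_prop]

lemma lengthDist_le_segmentDist (y z : X) : K.lengthDist y z ≤ K.segmentDist y z := by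
  unfold lengthDist
  refine iInf_le_of_le 1 <| iInf_le_of_le (fun k => if k = 0 then y else z) <|
    iInf_le_of_le (by simp) <| iInf_le_of_le (by simp) ?_
  simp

/-- Induction along broken lines. -/
lemma chain_induction {y : X} {C : X → ℝ≥0∞ → Prop} (h0 : ∀ L, 0 < L → C y L)
    (hs : ∀ (i : K.ι) (p q : K.V i) (L : ℝ≥0∞), p ∈ K.cell i → q ∈ K.cell i →
      C (K.proj i p) L → C (K.proj i q) (L + edist p q))
    (hm : ∀ z L L', L ≤ L' → C z L → C z L') {z : X} {L : ℝ≥0∞} (h : K.lengthDist y z < L) :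
    C z L := by
  obtain ⟨n, c, hc0, rfl, hL⟩ := lengthDist_lt_iff.1 h
  clear h
  induction n generalizing L with
  | zero => rw [hc0]; exact h0 L (by simpa using hL)
  | succ n ih =>
    rw [Finset.sum_range_succ] at hL
    obtain ⟨e, he, hlt⟩ := ENNReal.lt_iff_exists_add_pos_lt.1 hL
    have he' : (0 : ℝ≥0∞) < e := by exact_mod_cast he
    have hs1 : ∑ k ∈ Finset.range n, K.segmentDist (c k) (c (k + 1)) ≠ ⊤ :=
      (le_self_add.trans_lt hL).ne_top
    have hs2 : K.segmentDist (c n) (c (n + 1)) ≠ ⊤ := (le_add_self.trans_lt hL).ne_top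
    have he2 : (e / 2 : ℝ≥0∞) ≠ 0 := by simpa using he.ne'
    obtain ⟨i, p, hp, q, hq, h1, h2, h3⟩ := segmentDist_lt_iff.1
      (ENNReal.lt_add_right hs2 he2)
    have := ih (ENNReal.lt_add_right hs1 he2)
    rw [← h1] at this
    rw [← h2]
    refine hm _ _ _ ?_ (hs i p q _ hp hq this)
    refine (add_le_add le_rfl h3.le).trans (le_trans (le_of_eq ?_) hlt.le)
    rw [add_add_add_comm, ENNReal.add_halves]

end Complex

/-! ### Homotheties towards a point of the space -/

namespace Space

open FinslerPL.Complex

variable {X : Type u} [EMetricSpace X] {S : Space.{u, v, w} X} {x : X} {r : ℝ}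

lemma edist_proj_le {i : S.ι} {p q : S.V i} (hp : p ∈ S.cell i) (hq : q ∈ S.cell i) :
    edist (S.proj i p) (S.proj i q) ≤ edist p q := by
  rw [S.edist_eq]
  exact (lengthDist_le_segmentDist _ _).trans (segmentDist_le hp hq)

/-- Induction along a broken line. Within a cell both ends of a segment are shrunk towards one lift
of `x`, which multiplies its length by `l`; between cells the radius is carried over by
`IsConeRadius.transfer`. The bound by `r` keeps the line inside the cone. -/
lemma exists_apex_aux (h : S.IsConeRadius x r) {i : S.ι} {p q : S.V i}
    (hp : p ∈ S.cell i) (hx : S.proj i p = x) (hq : q ∈ S.cell i)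
    {z : X} {L : ℝ≥0∞} (hL : edist (S.proj i q) z < L) :
    edist q p + L < ENNReal.ofReal r →
    ∀ (j : S.ι), ∀ q' ∈ S.cell j, S.proj j q' = z → ∃ p' ∈ S.cell j, S.proj j p' = x ∧
      edist q' p' ≤ edist q p + L ∧ ∀ l ∈ Icc (0 : ℝ) 1,
        edist (S.proj i (AffineMap.lineMap p q l)) (S.proj j (AffineMap.lineMap p' q' l)) ≤
          ENNReal.ofReal l * L := by
  rw [S.edist_eq] at hL
  have hlt : ∀ {k : S.ι} {a b : S.V k}, edist a b < ENNReal.ofReal r → dist a b < r := by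
    intro k a b hab
    rwa [edist_dist, ENNReal.ofReal_lt_ofReal_iff h.pos] at hab
  refine chain_induction (C := fun z L => edist q p + L < ENNReal.ofReal r →
    ∀ (j : S.ι), ∀ q' ∈ S.cell j, S.proj j q' = z → ∃ p' ∈ S.cell j, S.proj j p' = x ∧
      edist q' p' ≤ edist q p + L ∧ ∀ l ∈ Icc (0 : ℝ) 1,
        edist (S.proj i (AffineMap.lineMap p q l)) (S.proj j (AffineMap.lineMap p' q' l)) ≤
          ENNReal.ofReal l * L) ?_ ?_ ?_ hL
  · intro L hL hr j q' hq' hz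
    obtain ⟨p', hp', h1, h2, h3⟩ := h.transfer hp hx hq (hlt (le_self_add.trans_lt hr)) hq' hz.symm
    refine ⟨p', hp', h1, ?_, fun l hl => ?_⟩
    · rw [edist_dist, h2, ← edist_dist]; exact le_self_add
    · rw [h3 l hl, edist_self]; exact zero_le
  · intro k a b L ha hb ih hr j q' hq' hz
    rw [← add_assoc] at hr
    obtain ⟨p', hp', h1, h2, h3⟩ := ih (le_self_add.trans_lt hr) k a ha rfl
    have hb' : edist b p' ≤ edist q p + (L + edist a b) := by
      calc edist b p' ≤ edist b a + edist a p' := edist_triangle _ _ _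
        _ ≤ edist a b + (edist q p + L) := by rw [edist_comm b a]; gcongr
        _ = _ := by ring
    obtain ⟨p₂, hp₂, h4, h5, h6⟩ := h.transfer hp' h1 hb
      (hlt (hb'.trans_lt (by rwa [← add_assoc]))) hq' hz.symm
    refine ⟨p₂, hp₂, h4, ?_, fun l hl => ?_⟩
    · rw [edist_dist, h5, ← edist_dist]; exact hb'
    · rw [h6 l hl, mul_add]
      refine (edist_triangle _ _ _).trans (add_le_add (h3 l hl) ?_)
      refine (edist_proj_le (lineMap_mem_cell hp' ha hl) (lineMap_mem_cell hp' hb hl)).trans ?_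
      rw [edist_dist, edist_dist, dist_lineMap_same_left _ _ _ hl.1, ENNReal.ofReal_mul hl.1]
  · intro z L L' hL ih hr j q' hq' hz
    obtain ⟨p', hp', h1, h2, h3⟩ := ih ((add_le_add le_rfl hL).trans_lt hr) j q' hq' hz
    refine ⟨p', hp', h1, h2.trans (add_le_add le_rfl hL), fun l hl => (h3 l hl).trans ?_⟩
    gcongr

/-- Homotheties centred at `x` multiply distances by at most their ratio. -/
lemma exists_apex (h : S.IsConeRadius x r) {i j : S.ι} {p q : S.V i} {q' : S.V j}
    (hp : p ∈ S.cell i) (hx : S.proj i p = x) (hq : q ∈ S.cell i) (hq' : q' ∈ S.cell j)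
    (hr : edist q p + edist (S.proj i q) (S.proj j q') < ENNReal.ofReal r) :
    ∃ p' ∈ S.cell j, S.proj j p' = x ∧
      edist q' p' ≤ edist q p + edist (S.proj i q) (S.proj j q') ∧ ∀ l ∈ Icc (0 : ℝ) 1,
        edist (S.proj i (AffineMap.lineMap p q l)) (S.proj j (AffineMap.lineMap p' q' l)) ≤
          ENNReal.ofReal l * edist (S.proj i q) (S.proj j q') := by
  set D := edist (S.proj i q) (S.proj j q')
  have hD : D ≠ ⊤ := (le_add_self.trans_lt hr).ne_top
  have hlt : ∀ {k : S.ι} {a b : S.V k}, edist a b < ENNReal.ofReal r → dist a b < r := by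
    intro k a b hab
    rwa [edist_dist, ENNReal.ofReal_lt_ofReal_iff h.pos] at hab
  obtain ⟨e, he, hlt'⟩ := ENNReal.lt_iff_exists_add_pos_lt.1 hr
  have key : ∀ d : NNReal, 0 < d → d ≤ e → ∃ p' ∈ S.cell j, S.proj j p' = x ∧
      edist q' p' ≤ edist q p + (D + d) ∧ ∀ l ∈ Icc (0 : ℝ) 1,
        edist (S.proj i (AffineMap.lineMap p q l)) (S.proj j (AffineMap.lineMap p' q' l)) ≤
          ENNReal.ofReal l * (D + d) := by
    intro d hd hde
    refine exists_apex_aux h hp hx hq (ENNReal.lt_add_right hD (by exact_mod_cast hd.ne')) ?_ j q'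
      hq' rfl
    rw [← add_assoc]
    exact lt_of_le_of_lt (by gcongr) hlt'
  obtain ⟨p', hp', h1, h2, h3⟩ := key e he le_rfl
  -- The lifts found for different slacks `d` coincide by uniqueness of the apex, so `d` can tend to
  -- `0` with `p'` fixed.
  have key2 : ∀ d : NNReal, 0 < d → d ≤ e → edist q' p' ≤ edist q p + (D + d) ∧
      ∀ l ∈ Icc (0 : ℝ) 1,
        edist (S.proj i (AffineMap.lineMap p q l)) (S.proj j (AffineMap.lineMap p' q' l)) ≤
          ENNReal.ofReal l * (D + d) := by
    intro d hd hde
    obtain ⟨p₂, hp₂, h4, h5, h6⟩ := key d hd hde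
    have : p' = p₂ := by
      refine h.eq_of_dist_lt (q := q') hp' h1 hp₂ h4 (hlt (h2.trans_lt ?_)) (hlt (h5.trans_lt ?_))
      · rwa [← add_assoc]
      · rw [← add_assoc]; exact lt_of_le_of_lt (by gcongr) hlt'
    subst this
    exact ⟨h5, h6⟩
  refine ⟨p', hp', h1, ?_, fun l hl => ?_⟩
  · refine ENNReal.le_of_forall_pos_le_add fun d hd _ => ?_
    refine ((key2 (min d e) (lt_min hd he) (min_le_right _ _)).1).trans ?_
    rw [add_assoc]
    gcongr
    exact min_le_left _ _
  · refine ENNReal.le_of_forall_pos_le_add fun d hd _ => ?_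
    refine ((key2 (min d e) (lt_min hd he) (min_le_right _ _)).2 l hl).trans ?_
    rw [mul_add]
    gcongr
    calc ENNReal.ofReal l * ((min d e : NNReal) : ℝ≥0∞) ≤ 1 * (d : ℝ≥0∞) := by
          gcongr
          · exact ENNReal.ofReal_le_one.2 hl.2
          · exact min_le_left _ _
      _ = d := one_mul _

lemma exists_apex_of_edist_lt (h : S.IsConeRadius x r) {j : S.ι} {q : S.V j}
    (hq : q ∈ S.cell j) (hr : edist x (S.proj j q) < ENNReal.ofReal r) :
    ∃ p ∈ S.cell j, S.proj j p = x ∧ edist p q = edist x (S.proj j q) := by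
  obtain ⟨i, p₀, hp₀, rfl⟩ := S.exists_proj_eq x
  obtain ⟨p, hp, h1, h2, -⟩ := exists_apex h hp₀ rfl hp₀ hq (by simpa using hr)
  refine ⟨p, hp, h1, le_antisymm (by simpa [edist_comm] using h2) ?_⟩
  rw [← h1]
  exact edist_proj_le hp hq

lemma edist_eq_of_dist_lt (h : S.IsConeRadius x r) {j : S.ι} {p q : S.V j}
    (hp : p ∈ S.cell j) (hx : S.proj j p = x) (hq : q ∈ S.cell j) (hr : dist p q < r) :
    edist x (S.proj j q) = edist p q := by
  have hlt : edist x (S.proj j q) < ENNReal.ofReal r := by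
    rw [← hx]
    refine (edist_proj_le hp hq).trans_lt ?_
    rwa [edist_dist, ENNReal.ofReal_lt_ofReal_iff h.pos]
  obtain ⟨p', hp', h1, h2⟩ := exists_apex_of_edist_lt h hq hlt
  rw [← h2, h.eq_of_dist_lt (q := q) hp hx hp' h1 (by rwa [dist_comm]) ?_]
  rwa [← h2, edist_dist, ENNReal.ofReal_lt_ofReal_iff h.pos, dist_comm] at hlt

end Space

/-- Continuous induction on an interval. -/
lemma real_induction {a b : ℝ} {P : ℝ → Prop}
    (h : ∀ t ∈ Icc a b, (∀ s ∈ Ico a t, P s) →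
      ∃ η > 0, ∀ s ∈ Icc a b, t ≤ s → s < t + η → P s) :
    ∀ t ∈ Icc a b, P t := by
  by_contra! hcon
  obtain ⟨t₀, ht₀, hP⟩ := hcon
  set B := {t ∈ Icc a b | ¬ P t} with hB
  have hne : B.Nonempty := ⟨t₀, ht₀, hP⟩
  have hbdd : BddBelow B := ⟨a, fun t ht => ht.1.1⟩
  have hT : sInf B ∈ Icc a b :=
    ⟨le_csInf hne fun t ht => ht.1.1, (csInf_le hbdd ⟨ht₀, hP⟩).trans ht₀.2⟩
  obtain ⟨η, hη, hs⟩ := h (sInf B) hT fun s hs => by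
    by_contra hPs
    exact absurd (csInf_le hbdd ⟨⟨hs.1, hs.2.le.trans hT.2⟩, hPs⟩) (not_le.2 hs.2)
  obtain ⟨t, ht, htlt⟩ := exists_lt_of_csInf_lt hne (lt_add_of_pos_right (sInf B) hη)
  exact ht.2 (hs t ht.1 (csInf_le hbdd ht) htlt)

lemma eq_lineMap_of_dist_add {V : Type w} [NormedAddCommGroup V] [NormedSpace ℝ V]
    [StrictConvexSpace ℝ V] {p y q : V} (h : dist p y + dist y q = dist p q) (hpq : 0 < dist p q) :
    y = AffineMap.lineMap p q (dist p y / dist p q) := by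
  obtain ⟨t, ht, rfl⟩ := dist_add_dist_eq_iff.1 h
  rw [dist_left_lineMap, Real.norm_of_nonneg ht.1, mul_div_assoc, div_self hpq.ne', mul_one]

lemma lineMap_lineMap_left_end {V : Type w} [NormedAddCommGroup V] [NormedSpace ℝ V] (p q : V)
    (c d : ℝ) :
    AffineMap.lineMap p (AffineMap.lineMap p q c) d = AffineMap.lineMap p q (d * c) := by
  simp [AffineMap.lineMap_apply, smul_smul]

lemma dist_eq_toReal {V : Type*} [PseudoMetricSpace V] {p q : V} {L : ℝ≥0∞} (h : edist p q = L) :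
    dist p q = L.toReal := by
  rw [← h, edist_dist, ENNReal.toReal_ofReal dist_nonneg]

lemma exists_delta_of_continuousOn {X : Type u} [EMetricSpace X] {σ : ℝ → X} {A : Set ℝ}
    (hσ : ContinuousOn σ A) {t : ℝ} (ht : t ∈ A) {ρ : ℝ} (hρ : 0 < ρ) :
    ∃ η > 0, ∀ s ∈ A, |s - t| < η → edist (σ t) (σ s) < ENNReal.ofReal ρ := by
  have h1 : ∀ᶠ s in 𝓝[A] t, edist (σ s) (σ t) < ENNReal.ofReal ρ :=
    (hσ t ht).eventually (Metric.eball_mem_nhds _ (ENNReal.ofReal_pos.2 hρ))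
  rw [eventually_nhdsWithin_iff, Metric.eventually_nhds_iff] at h1
  obtain ⟨η, hη, h⟩ := h1
  exact ⟨η, hη, fun s hs hst => by rw [edist_comm]; exact h hst hs⟩

/-! ### Shortest paths from the apex of a cone -/

namespace Space

open FinslerPL.Complex

variable {X : Type u} [EMetricSpace X] {S : Space.{u, v, w} X} {x : X} {r : ℝ}

/-- A shortest path that starts at the apex of a cone is radial. -/
lemma eq_proj_lineMap_of_additive (h : S.IsConeRadius x r) {σ : ℝ → X} {a b : ℝ}
    (hσ : ContinuousOn σ (Icc a b))
    (hadd : ∀ s ∈ Icc a b, ∀ t ∈ Icc a b, s ≤ t →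
      edist x (σ t) = edist x (σ s) + edist (σ s) (σ t))
    {j : S.ι} {p q : S.V j} (hp : p ∈ S.cell j) (hx : S.proj j p = x) (hq : q ∈ S.cell j)
    (hb : S.proj j q = σ b) (hd : dist p q < r) {s : ℝ} (hs : s ∈ Icc a b) :
    σ s = S.proj j (AffineMap.lineMap p q ((edist x (σ s)).toReal / (edist x (σ b)).toReal)) := by
  have hbb : b ∈ Icc a b := ⟨hs.1.trans hs.2, le_rfl⟩
  have hDb : edist x (σ b) < ENNReal.ofReal r := by
    rw [← hb, edist_eq_of_dist_lt h hp hx hq hd, edist_dist]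
    exact (ENNReal.ofReal_lt_ofReal_iff h.pos).2 hd
  have hDle : ∀ t ∈ Icc a b, edist x (σ t) < ENNReal.ofReal r := fun t ht =>
    lt_of_le_of_lt (by rw [hadd t ht b hbb ht.2]; exact le_self_add) hDb
  rcases eq_or_ne x (σ s) with hxs | hxs
  · rw [← hxs]; simp [hx]
  set D : ℝ → ℝ := fun t => (edist x (σ t)).toReal with hD
  have hDs : 0 < D s := ENNReal.toReal_pos (edist_pos.2 hxs).ne' (hDle s hs).ne_top
  have hDadd : ∀ t ∈ Icc a b, ∀ t' ∈ Icc a b, t ≤ t' →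
      D t' = D t + (edist (σ t) (σ t')).toReal := fun t ht t' ht' htt => by
    have h1 := hadd t ht t' ht' htt
    have h2 : edist (σ t) (σ t') ≠ ⊤ :=
      (lt_of_le_of_lt (by rw [h1]; exact le_add_self) (hDle t' ht')).ne_top
    simp only [hD]
    rw [h1, ENNReal.toReal_add (hDle t ht).ne_top h2]
  have hDpos : ∀ t ∈ Icc s b, 0 < D t := fun t ht => by
    rw [hDadd s hs t ⟨hs.1.trans ht.1, ht.2⟩ ht.1]; positivity
  have hDlt : ∀ t ∈ Icc a b, D t < r := fun t ht =>
    (ENNReal.lt_ofReal_iff_toReal_lt (hDle t ht).ne_top).1 (hDle t ht)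
  -- Continuous induction on `t`, for all lifts at once: the radius from `x` to `σ t` passes through
  -- `σ s`.
  have key : ∀ t ∈ Icc s b, ∀ (j : S.ι) (p q : S.V j), p ∈ S.cell j → S.proj j p = x →
      q ∈ S.cell j → S.proj j q = σ t → dist p q < r →
      S.proj j (AffineMap.lineMap p q (D s / D t)) = σ s := by
    refine real_induction fun t ht ih => ?_
    have hta : t ∈ Icc a b := ⟨hs.1.trans ht.1, ht.2⟩
    obtain ⟨ρ, hρ⟩ := S.exists_isConeRadius (σ t)
    obtain ⟨η, hη, hcont⟩ := exists_delta_of_continuousOn hσ hta hρ.pos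
    have hPt : ∀ (j : S.ι) (p q : S.V j), p ∈ S.cell j → S.proj j p = x →
        q ∈ S.cell j → S.proj j q = σ t → dist p q < r →
        S.proj j (AffineMap.lineMap p q (D s / D t)) = σ s := by
      rcases ht.1.eq_or_lt with rfl | hst
      · intro j p q hp hx hq hqt hd
        rw [div_self hDs.ne', AffineMap.lineMap_apply_one, hqt]
      intro j p q hp hx hq hqt hd
      obtain ⟨t', h1, h2⟩ := exists_between (max_lt hst (sub_lt_self t hη))
      rw [max_lt_iff] at h1
      have ht' : t' ∈ Icc a b := ⟨hs.1.trans h1.1.le, h2.le.trans ht.2⟩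
      have hc := hcont t' ht' (by rw [abs_lt]; constructor <;> linarith)
      -- The cone structures at `x` and at `σ t` put lifts of both into one cell with a lift of `σ
      -- t'`. There additivity is equality in the triangle inequality, so strict convexity makes the
      -- three lifts collinear.
      obtain ⟨k, q', hq', hqt'⟩ := S.exists_proj_eq (σ t')
      rw [← hqt'] at hc
      obtain ⟨y', hy', hy1, hy2⟩ := exists_apex_of_edist_lt hρ hq' hc
      have hc2 := hDle t' ht'
      rw [← hqt'] at hc2
      obtain ⟨p', hp', hp1, hp2⟩ := exists_apex_of_edist_lt h hq' hc2
      rw [hqt'] at hp2 hy2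
      have e1 : dist p' q' = D t' := dist_eq_toReal hp2
      have e2 : dist q' y' = (edist (σ t') (σ t)).toReal := by
        rw [dist_comm, edist_comm]; exact dist_eq_toReal hy2
      have e3 := hDadd t' ht' t hta h2.le
      have e4 : dist p' y' ≤ D t := by
        rw [e3, ← e1, ← e2]; exact dist_triangle _ _ _
      have e5 : dist p' y' = D t := by
        refine dist_eq_toReal ?_
        rw [← edist_eq_of_dist_lt h hp' hp1 hy' (e4.trans_lt (hDlt t hta)), hy1]
      have e6 := eq_lineMap_of_dist_add (p := p') (y := q') (q := y') (by
        rw [e1, e2, e5, e3]) (by rw [e5]; exact hDpos t ht)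
      have e7 := ih t' ⟨h1.1.le, h2⟩ k p' q' hp' hp1 hq' hqt' (e1.trans_lt (hDlt t' ht'))
      rw [e6, e1, e5, lineMap_lineMap_left_end,
        div_mul_div_cancel₀ (hDpos t' ⟨h1.1.le, ht'.2⟩).ne'] at e7
      obtain ⟨p₂, hp₂, e8, e9, e10⟩ := h.transfer hp' hp1 hy'
        (by rw [dist_comm]; exact e4.trans_lt (hDlt t hta)) hq (hy1.trans hqt.symm)
      have : p₂ = p := h.eq_of_dist_lt (q := q) hp₂ e8 hp hx
        (by rw [e9, dist_comm]; exact e4.trans_lt (hDlt t hta)) (by rwa [dist_comm])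
      subst this
      rw [e10 _ ⟨by have := hDpos t ht; positivity, ?_⟩, e7]
      rw [div_le_one (hDpos t ht), hDadd s hs t hta ht.1]
      simp
    refine ⟨η, hη, fun t' ht' htt hlt j p q hp hx hq hqt hd => ?_⟩
    have hta' : t' ∈ Icc a b := ⟨hs.1.trans ht'.1, ht'.2⟩
    have hc := hcont t' hta' (by rw [abs_lt]; constructor <;> linarith)
    rw [← hqt] at hc
    obtain ⟨y, hy, hy1, hy2⟩ := exists_apex_of_edist_lt hρ hq hc
    rw [hqt] at hy2
    have e1 : dist p q = D t' := by
      refine dist_eq_toReal ?_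
      rw [← edist_eq_of_dist_lt h hp hx hq hd, hqt]
    have e2 : dist y q = (edist (σ t) (σ t')).toReal := dist_eq_toReal hy2
    have e3 := hDadd t hta t' hta' htt
    have hc2 := hDle t hta
    have e4 : dist p y = D t := by
      obtain ⟨p', hp', e5, e6⟩ := exists_apex_of_edist_lt h hy (by rwa [hy1])
      rw [hy1] at e6
      have e7 : dist p' y = D t := dist_eq_toReal e6
      have : p' = p := by
        refine h.eq_of_dist_lt (q := q) hp' e5 hp hx ?_ (by rwa [dist_comm])
        rw [dist_comm]
        calc dist p' q ≤ dist p' y + dist y q := dist_triangle _ _ _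
          _ = D t' := by rw [e7, e2, e3]
          _ < r := hDlt t' hta'
      rwa [← this]
    have e6 := eq_lineMap_of_dist_add (p := p) (y := y) (q := q) (by
        rw [e1, e2, e4, e3]) (by rw [e1]; exact hDpos t' ht')
    have e7 := hPt j p y hp hx hy hy1 (e4.trans_lt (hDlt t hta))
    rwa [e6, e1, e4, lineMap_lineMap_left_end, div_mul_div_cancel₀ (hDpos t ht).ne'] at e7
  exact (key b ⟨hs.2, le_rfl⟩ j p q hp hx hq hb hd).symm

end Space

/-! ### The differential of a norm -/

section Norm

variable {V : Type w} [NormedAddCommGroup V] [NormedSpace ℝ V]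

lemma abs_fderiv_norm_le (u v : V) : |fderiv ℝ (fun x : V => ‖x‖) u v| ≤ ‖v‖ := by
  have h1 : ‖fderiv ℝ (fun x : V => ‖x‖) u‖ ≤ 1 := by
    simpa using norm_fderiv_le_of_lipschitz ℝ (C := 1) (f := fun x : V => ‖x‖) (x₀ := u)
      lipschitzWith_one_norm
  have h2 := (fderiv ℝ (fun x : V => ‖x‖) u).le_of_opNorm_le h1 v
  simpa using h2

/-- The differential has norm at most one and equals `1` at `u`, so the hypothesis gives `‖u‖ + ‖v‖
≤ ‖u + v‖`; strict convexity puts `u` and `v` on one ray. -/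
lemma eq_smul_of_norm_le_fderiv [StrictConvexSpace ℝ V] {u v : V}
    (hd : DifferentiableAt ℝ (fun x : V => ‖x‖) u) (hu : ‖u‖ = 1)
    (h : ‖v‖ ≤ fderiv ℝ (fun x : V => ‖x‖) u v) : v = ‖v‖ • u := by
  have h1 : fderiv ℝ (fun x : V => ‖x‖) u u = 1 := by rw [hd.fderiv_norm_self, hu]
  have h2 : SameRay ℝ u v := by
    rw [sameRay_iff_norm_add]
    refine le_antisymm (norm_add_le _ _) ?_
    have := (le_abs_self _).trans (abs_fderiv_norm_le u (u + v))
    rw [map_add, h1] at this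
    rw [hu]
    linarith
  have := h2.norm_smul_eq
  rw [hu, one_smul] at this
  exact this

lemma eventually_norm_smul_sub_le {u v : V} (hd : DifferentiableAt ℝ (fun x : V => ‖x‖) u)
    (hu : ‖u‖ = 1) {T κ : ℝ} (hT : 0 < T) (hκ : 0 < κ) :
    ∀ᶠ l in 𝓝[>] (0 : ℝ),
      ‖T • u - l • v‖ ≤ T - l * (fderiv ℝ (fun x : V => ‖x‖) u v - κ) := by
  have hd' : HasFDerivAt (fun x : V => ‖x‖) (fderiv ℝ (fun x : V => ‖x‖) u) (T • u) :=
    hd.hasFDerivAt.hasFDerivAt_norm_smul_pos hT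
  have hline : HasDerivAt (fun l : ℝ => T • u - l • v) (-v) 0 := by
    simpa using ((hasDerivAt_id (0 : ℝ)).smul_const v).const_sub (T • u)
  have hcomp := (HasFDerivAt.comp_hasDerivAt_of_eq (0 : ℝ) hd' hline (by simp))
  have hlo := (hasDerivAt_iff_isLittleO.1 hcomp).def hκ
  filter_upwards [hlo.filter_mono nhdsWithin_le_nhds, self_mem_nhdsWithin] with l hl hl0
  have hl0' : (0 : ℝ) < l := hl0
  simp only [Function.comp, zero_smul, sub_zero, norm_smul, hu, map_neg, smul_eq_mul,
    Real.norm_of_nonneg hT.le, Real.norm_of_nonneg hl0'.le, mul_one] at hl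
  have := (abs_le.1 (by simpa using hl)).2
  linarith

end Norm

namespace Space

open FinslerPL.Complex

variable {X : Type u} [EMetricSpace X] {S : Space.{u, v, w} X}

lemma differentiableAt_norm {j : S.ι} {u : S.V j} (hu : ‖u‖ = 1) :
    DifferentiableAt ℝ (fun x : S.V j => ‖x‖) u := by
  have h0 : u ≠ 0 := by rintro rfl; simp at hu
  exact ((S.contDiffOn_norm j).contDiffAt (isOpen_compl_singleton.mem_nhds h0)).differentiableAt
    one_ne_zero

/-! ### Directions of a curve -/

/-- Near the point `y` over `γ t`, the curve `γ` is the unit speed line of direction `u`. -/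
structure IsDir (S : Space.{u, v, w} X) (γ : ℝ → X) (η t : ℝ) (j : S.ι) (y u : S.V j) : Prop where
  norm_eq : ‖u‖ = 1
  mem : ∀ h, |h| < η → y + h • u ∈ S.cell j
  proj_eq : ∀ h, |h| < η → S.proj j (y + h • u) = γ (t + h)

variable {γ : ℝ → X}

/-- For small `k` both `y + k • u` and `y + k • u'` have the same minimal face as `y`, and both lie
over `γ (t + k)`; the projection is injective there. -/
lemma IsDir.unique {η η' t : ℝ} {j : S.ι} {y u u' : S.V j} (hη : 0 < η) (hη' : 0 < η')
    (h : S.IsDir γ η t j y u) (h' : S.IsDir γ η' t j y u') : u = u' := by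
  have hface : ∀ {η : ℝ} {u : S.V j}, S.IsDir γ η t j y u → ∀ k, |2 * k| < η →
      face (S.cell j) (y + k • u) = face (S.cell j) y := by
    intro η u h k hk
    have hk' : |k| < η := by
      rw [abs_mul, abs_two] at hk
      linarith [abs_nonneg k]
    refine (S.isPolyhedral_cell j).face_eq ⟨h.mem k hk', 1, one_pos, ?_⟩
      ⟨by simpa using h.mem 0 (by simpa using (abs_nonneg k).trans_lt hk'), 1, one_pos, ?_⟩
    · convert h.mem (-k) (by rwa [abs_neg]) using 1
      module
    · convert h.mem (2 * k) hk using 1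
      module
  set k := min η η' / 4
  have hk : 0 < k := by positivity
  have hk1 : |2 * k| < η := by
    rw [abs_of_pos (by positivity)]
    have := min_le_left η η'
    simp only [k]; linarith
  have hk2 : |2 * k| < η' := by
    rw [abs_of_pos (by positivity)]
    have := min_le_right η η'
    simp only [k]; linarith [lt_min hη hη']
  have hk1' : |k| < η := by
    rw [abs_of_pos hk]; rw [abs_of_pos (by positivity)] at hk1; linarith
  have hk2' : |k| < η' := by
    rw [abs_of_pos hk]; rw [abs_of_pos (by positivity)] at hk2; linarith
  have h1 := hface h k hk1
  have h2 := hface h' k hk2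
  have := S.injOn_face (p := y + k • u) (q := y + k • u')
    (by rw [h1, ← h2]; exact self_mem_face (h'.mem k hk2'))
    (by rw [h2, ← h1]; exact self_mem_face (h.mem k hk1'))
    ((h.proj_eq k hk1').trans (h'.proj_eq k hk2').symm)
  exact smul_right_injective _ hk.ne' (add_left_cancel this)

/-- Past the starting point, a curve that is isometric near that point is straight. -/
lemma exists_dir_of_isometric {σ : ℝ → X} {r ℓ τ : ℝ} (hr : S.IsConeRadius (σ 0) r) (hℓ : ℓ ≤ r)
    (hσ : ∀ s ∈ Ico 0 ℓ, ∀ t ∈ Ico 0 ℓ, edist (σ s) (σ t) = ENNReal.ofReal |s - t|)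
    (hτ : τ ∈ Ioo 0 ℓ) :
    ∃ η, 0 < η ∧ η ≤ τ ∧ ∀ (j : S.ι) (y : S.V j), y ∈ S.cell j → S.proj j y = σ τ →
      ∃ u : S.V j, ‖u‖ = 1 ∧ ∀ h ∈ Ico (-τ) η,
        y + h • u ∈ S.cell j ∧ S.proj j (y + h • u) = σ (τ + h) := by
  obtain ⟨hτ0, hτℓ⟩ := hτ
  obtain ⟨b, hτb, hbℓ⟩ := exists_between hτℓ
  have hb0 : 0 < b := hτ0.trans hτb
  have hmem : ∀ s ∈ Icc 0 b, s ∈ Ico 0 ℓ := fun s hs => ⟨hs.1, hs.2.trans_lt hbℓ⟩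
  have hdist : ∀ s ∈ Icc 0 b, edist (σ 0) (σ s) = ENNReal.ofReal s := fun s hs => by
    rw [hσ 0 ⟨le_rfl, hb0.trans hbℓ⟩ s (hmem s hs), zero_sub, abs_neg, abs_of_nonneg hs.1]
  have hbb : b ∈ Icc 0 b := ⟨hb0.le, le_rfl⟩
  obtain ⟨i, q, hq, hqb⟩ := S.exists_proj_eq (σ b)
  obtain ⟨p, hp, hx, hpq⟩ := exists_apex_of_edist_lt hr hq (by
    rw [hqb, hdist b hbb]
    exact (ENNReal.ofReal_lt_ofReal_iff hr.pos).2 (hbℓ.trans_le hℓ))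
  rw [hqb, hdist b hbb] at hpq
  have hpq' : dist p q = b := by rw [dist_eq_toReal hpq, ENNReal.toReal_ofReal hb0.le]
  have hcont : ContinuousOn σ (Icc 0 b) := by
    have : LipschitzOnWith 1 σ (Icc 0 b) := fun s hs t ht => by
      rw [hσ s (hmem s hs) t (hmem t ht), edist_dist, Real.dist_eq]
      simp
    exact this.continuousOn
  set u₀ : S.V i := b⁻¹ • (q - p) with hu₀
  have hline : ∀ s, AffineMap.lineMap p q (s / b) = p + s • u₀ := fun s => by
    rw [AffineMap.lineMap_apply, vsub_eq_sub, vadd_eq_add, hu₀, smul_smul, div_eq_mul_inv, add_comm]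
  have hcell : ∀ s ∈ Icc 0 b, p + s • u₀ ∈ S.cell i := fun s hs => by
    rw [← hline]
    exact lineMap_mem_cell hp hq ⟨div_nonneg hs.1 hb0.le, (div_le_one hb0).2 hs.2⟩
  have hproj : ∀ s ∈ Icc 0 b, S.proj i (p + s • u₀) = σ s := fun s hs => by
    have := eq_proj_lineMap_of_additive hr hcont (fun s hs t ht hst => by
      rw [hdist s hs, hdist t ht, hσ s (hmem s hs) t (hmem t ht), abs_sub_comm,
        abs_of_nonneg (sub_nonneg.2 hst), ← ENNReal.ofReal_add hs.1 (sub_nonneg.2 hst)]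
      congr 1; ring) hp hx hq hqb (by rw [hpq']; exact hbℓ.trans_le hℓ) hs
    rw [this, hdist s hs, hdist b hbb, ENNReal.toReal_ofReal hs.1, ENNReal.toReal_ofReal hb0.le,
      hline]
  have hnorm : ‖u₀‖ = 1 := by
    rw [hu₀, norm_smul, norm_inv, Real.norm_of_nonneg hb0.le, ← dist_eq_norm, dist_comm, hpq',
      inv_mul_cancel₀ hb0.ne']
  set η := min τ (b - τ) with hηdef
  have hη : 0 < η := lt_min hτ0 (sub_pos.2 hτb)
  have hητ : η ≤ τ := min_le_left _ _
  have hηb : η ≤ b - τ := min_le_right _ _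
  refine ⟨η, hη, hητ, fun j y hy hyτ => ?_⟩
  set y₀ := p + τ • u₀ with hy₀
  have hy₀' : ∀ h, y₀ + h • u₀ = p + (τ + h) • u₀ := fun h => by rw [hy₀]; module
  have hτb' : τ ∈ Icc 0 b := ⟨hτ0.le, hτb.le⟩
  have hI : ∀ h ∈ Ico (-τ) η, τ + h ∈ Icc 0 b := fun h hh =>
    ⟨by linarith [hh.1], by linarith [hh.2]⟩
  -- Since `y₀` is inside the segment, its face contains the nearby part and everything back to `p`,
  -- so the line can be glued to any cell over `σ τ`. As `|h| ≤ τ`, the factor `η / (2 * τ)` moves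
  -- at most `η / 2` beyond `y₀`.
  have hface : ∀ h ∈ Ico (-τ) η, y₀ + h • u₀ ∈ face (S.cell i) y₀ := fun h hh => by
    refine ⟨by rw [hy₀']; exact hcell _ (hI h hh), η / (2 * τ), by positivity, ?_⟩
    have : y₀ + (η / (2 * τ)) • (y₀ - (y₀ + h • u₀)) = p + (τ - η / (2 * τ) * h) • u₀ := by
      rw [hy₀]; module
    rw [this]
    have habs : |η / (2 * τ) * h| ≤ η / 2 := by
      rw [abs_mul, abs_of_pos (by positivity : 0 < η / (2 * τ))]
      have : |h| ≤ τ := abs_le.2 ⟨hh.1, hh.2.le.trans hητ⟩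
      calc η / (2 * τ) * |h| ≤ η / (2 * τ) * τ := by gcongr
        _ = η / 2 := by field_simp
    rw [abs_le] at habs
    exact hcell _ ⟨by linarith [habs.2], by linarith [habs.1]⟩
  obtain ⟨g, hg, hgf⟩ := S.exists_glue (hcell τ hτb') hy ((hproj τ hτb').trans hyτ.symm)
  rw [← hy₀] at hg hgf
  have hglin : ∀ h : ℝ, g (y₀ + h • u₀) = y + h • g.linear u₀ := fun h => by
    rw [add_comm, ← vadd_eq_add, g.map_vadd, map_smul, hg, vadd_eq_add, add_comm]
  refine ⟨g.linear u₀, ?_, fun h hh => ?_⟩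
  · have hh : η / 2 ∈ Ico (-τ) η := ⟨by linarith, by linarith⟩
    have := (hgf _ (hface _ hh)).2.1
    rw [hglin, dist_eq_norm, dist_eq_norm, add_sub_cancel_left, add_sub_cancel_left, norm_smul,
      norm_smul, hnorm, mul_one, mul_eq_left₀ (by simpa using hη.ne')] at this
    exact this
  · obtain ⟨h1, -, h2⟩ := hgf _ (hface h hh)
    rw [hglin] at h1 h2
    exact ⟨h1.1, by rw [h2, hy₀', hproj _ (hI h hh)]⟩

/-- `γ` is isometric on the part of `[0, L]` that lies within distance `δ` of `c`. -/
def IsIsometricNear (γ : ℝ → X) (L c δ : ℝ) : Prop :=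
  ∀ s ∈ Icc 0 L, ∀ t ∈ Icc 0 L, |s - c| < δ → |t - c| < δ →
    edist (γ s) (γ t) = ENNReal.ofReal |s - t|

variable {L c δ r : ℝ}

/-- The range starts at `h = c - t`, so the line in the cell of `y` reaches back to a lift of `γ c`;
the first variation at `γ c` relies on this. -/
lemma exists_dir_right (hr : S.IsConeRadius (γ c) r) (hδr : δ ≤ r)
    (hγ : IsIsometricNear γ L c δ) (hc : 0 ≤ c) {t : ℝ} (hct : c < t) (htδ : t < c + δ)
    (htL : t < L) :
    ∃ η, 0 < η ∧ η ≤ t - c ∧ ∀ (j : S.ι) (y : S.V j), y ∈ S.cell j → S.proj j y = γ t →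
      ∃ u : S.V j, ‖u‖ = 1 ∧ ∀ h ∈ Ico (c - t) η,
        y + h • u ∈ S.cell j ∧ S.proj j (y + h • u) = γ (t + h) := by
  obtain ⟨η, h1, h2, h3⟩ := exists_dir_of_isometric (S := S) (σ := fun h => γ (c + h)) (r := r)
    (ℓ := min δ (L - c)) (τ := t - c) (by simpa using hr) ((min_le_left _ _).trans hδr)
    (fun s hs t ht => by
      have hs1 := lt_min_iff.1 hs.2
      have ht1 := lt_min_iff.1 ht.2
      rw [hγ (c + s) ⟨by linarith [hs.1], by linarith⟩ (c + t) ⟨by linarith [ht.1], by linarith⟩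
        (by rw [add_sub_cancel_left, abs_of_nonneg hs.1]; exact hs1.1)
        (by rw [add_sub_cancel_left, abs_of_nonneg ht.1]; exact ht1.1), add_sub_add_left_eq_sub])
    ⟨by linarith, lt_min (by linarith) (by linarith)⟩
  refine ⟨η, h1, h2, fun j y hy hyt => ?_⟩
  obtain ⟨u, hu, hu'⟩ := h3 j y hy (by rw [hyt]; congr 1; ring)
  refine ⟨u, hu, fun h hh => ?_⟩
  obtain ⟨h4, h5⟩ := hu' h (by rwa [neg_sub])
  exact ⟨h4, by rw [h5]; congr 1; ring⟩

lemma exists_dir_left (hr : S.IsConeRadius (γ c) r) (hδr : δ ≤ r)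
    (hγ : IsIsometricNear γ L c δ) (hc : c ≤ L) {t : ℝ} (hct : t < c) (htδ : c - δ < t)
    (ht0 : 0 < t) :
    ∃ η, 0 < η ∧ η ≤ c - t ∧ ∀ (j : S.ι) (y : S.V j), y ∈ S.cell j → S.proj j y = γ t →
      ∃ u : S.V j, ‖u‖ = 1 ∧ ∀ h ∈ Ioc (-η) (c - t),
        y + h • u ∈ S.cell j ∧ S.proj j (y + h • u) = γ (t + h) := by
  obtain ⟨η, h1, h2, h3⟩ := exists_dir_of_isometric (S := S) (σ := fun h => γ (c - h)) (r := r)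
    (ℓ := min δ c) (τ := c - t) (by simpa using hr) ((min_le_left _ _).trans hδr)
    (fun s hs t ht => by
      have hs1 := lt_min_iff.1 hs.2
      have ht1 := lt_min_iff.1 ht.2
      rw [hγ (c - s) ⟨by linarith [hs.1], by linarith [hs.1]⟩ (c - t)
        ⟨by linarith [ht.1], by linarith [ht.1]⟩
        (by rw [sub_sub_cancel_left, abs_neg, abs_of_nonneg hs.1]; exact hs1.1)
        (by rw [sub_sub_cancel_left, abs_neg, abs_of_nonneg ht.1]; exact ht1.1),
        sub_sub_sub_cancel_left, abs_sub_comm])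
    ⟨by linarith, lt_min (by linarith) (by linarith)⟩
  refine ⟨η, h1, h2, fun j y hy hyt => ?_⟩
  obtain ⟨u, hu, hu'⟩ := h3 j y hy (by rw [hyt]; congr 1; ring)
  refine ⟨-u, by rwa [norm_neg], fun h hh => ?_⟩
  obtain ⟨h4, h5⟩ := hu' (-h) ⟨by linarith [hh.2], by linarith [hh.1]⟩
  rw [smul_neg, ← neg_smul]
  exact ⟨h4, by rw [h5]; congr 1; ring⟩

/-- Every point over `γ t` has a direction of `γ` on the interval of radius `η`. -/
def IsRegularAt (S : Space.{u, v, w} X) (γ : ℝ → X) (η t : ℝ) : Prop :=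
  ∀ (j : S.ι) (y : S.V j), y ∈ S.cell j → S.proj j y = γ t → ∃ u, S.IsDir γ η t j y u

lemma exists_isRegularAt (hr : S.IsConeRadius (γ c) r) (hδr : δ ≤ r)
    (hγ : IsIsometricNear γ L c δ) (hc : c ∈ Icc 0 L) {t : ℝ} (hct : t ≠ c) (htδ : |t - c| < δ)
    (ht : t ∈ Ioo 0 L) : ∃ η > 0, S.IsRegularAt γ η t := by
  rw [abs_lt] at htδ
  rcases hct.lt_or_gt with hct | hct
  · obtain ⟨η, h1, h2, h3⟩ := exists_dir_left hr hδr hγ hc.2 hct (by linarith) ht.1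
    refine ⟨η, h1, fun j y hy hyt => ?_⟩
    obtain ⟨u, hu, hu'⟩ := h3 j y hy hyt
    have : ∀ h, |h| < η → h ∈ Ioc (-η) (c - t) := fun h hh => by
      rw [abs_lt] at hh; exact ⟨hh.1, by linarith⟩
    exact ⟨u, hu, fun h hh => (hu' h (this h hh)).1, fun h hh => (hu' h (this h hh)).2⟩
  · obtain ⟨η, h1, h2, h3⟩ := exists_dir_right hr hδr hγ hc.1 hct (by linarith) ht.2
    refine ⟨η, h1, fun j y hy hyt => ?_⟩
    obtain ⟨u, hu, hu'⟩ := h3 j y hy hyt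
    have : ∀ h, |h| < η → h ∈ Ico (c - t) η := fun h hh => by
      rw [abs_lt] at hh; exact ⟨by linarith, hh.2⟩
    exact ⟨u, hu, fun h hh => (hu' h (this h hh)).1, fun h hh => (hu' h (this h hh)).2⟩

end Space

namespace Space

open FinslerPL.Complex

variable {X : Type u} [EMetricSpace X] {S : Space.{u, v, w} X} {γ : ℝ → X} {L c δ r : ℝ}

/-! ### First variation -/

/-- The distance `T` from `e` to the apex `x` decreases at rate at least `β` when the apex is moved
towards `z`. -/
def HasSide (S : Space.{u, v, w} X) (r : ℝ) (x e : X) (T : ℝ) (z : X) (β : ℝ) : Prop :=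
  ∃ (j : S.ι) (p q : S.V j), p ∈ S.cell j ∧ q ∈ S.cell j ∧ S.proj j p = x ∧ S.proj j q = z ∧
    dist q p < r / 3 ∧ ∀ κ > 0, ∀ᶠ l in 𝓝[>] (0 : ℝ), 0 ≤ T - l * (β - κ) ∧
      edist e (S.proj j (AffineMap.lineMap p q l)) ≤ ENNReal.ofReal (T - l * (β - κ))

/-- Going from `e` to `e'` through the images of `z` and `z'` under the homothety of ratio `l` gives
`T + T' ≤ (T - l * (β - κ)) + l * d(z, z') + (T' - l * (β' - κ))`. Divide by `l`; `κ` is arbitrary.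
-/
lemma HasSide.add_le {x e e' z z' : X} {T T' β β' : ℝ} (hr : S.IsConeRadius x r)
    (h : S.HasSide r x e T z β) (h' : S.HasSide r x e' T' z' β')
    (he : edist e e' = ENNReal.ofReal (T + T')) :
    ENNReal.ofReal (β + β') ≤ edist z z' := by
  obtain ⟨j, p, q, hp, hq, hx, rfl, hd, hs⟩ := h
  obtain ⟨j', p', q', hp', hq', hx', rfl, hd', hs'⟩ := h'
  have hr0 := hr.pos
  -- This is why `HasSide` asks for `r / 3`: then `d(q, p) + d(z, z') < r`, the range of
  -- `exists_apex`.
  have hzz : edist (S.proj j q) (S.proj j' q') < ENNReal.ofReal (2 * r / 3) := by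
    refine (edist_triangle _ x _).trans_lt ?_
    have h1 : edist (S.proj j q) x ≤ ENNReal.ofReal (dist q p) := by
      rw [← hx, ← edist_dist]; exact edist_proj_le hq hp
    have h2 : edist x (S.proj j' q') ≤ ENNReal.ofReal (dist q' p') := by
      rw [← hx', ← edist_dist, edist_comm]; exact edist_proj_le hq' hp'
    refine (add_le_add h1 h2).trans_lt ?_
    rw [← ENNReal.ofReal_add dist_nonneg dist_nonneg]
    exact (ENNReal.ofReal_lt_ofReal_iff (by positivity)).2 (by linarith)
  have hsum : edist q p + edist (S.proj j q) (S.proj j' q') < ENNReal.ofReal r := by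
    have : ENNReal.ofReal r = ENNReal.ofReal (r / 3) + ENNReal.ofReal (2 * r / 3) := by
      rw [← ENNReal.ofReal_add (by positivity) (by positivity)]; congr 1; ring
    rw [this, edist_dist]
    exact ENNReal.add_lt_add ((ENNReal.ofReal_lt_ofReal_iff (by positivity)).2 hd) hzz
  obtain ⟨p₂, hp₂, hx₂, h2, h3⟩ := exists_apex hr hp hx hq hq' hsum
  have : p₂ = p' := by
    refine hr.eq_of_dist_lt (q := q') hp₂ hx₂ hp' hx' ?_ (by linarith)
    have := h2.trans_lt hsum
    rwa [edist_dist, ENNReal.ofReal_lt_ofReal_iff hr0] at this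
  subst this
  set D := edist (S.proj j q) (S.proj j' q')
  have hD : D ≠ ⊤ := hzz.ne_top
  rw [ENNReal.ofReal_le_iff_le_toReal hD]
  refine le_of_forall_pos_le_add fun κ hκ => ?_
  obtain ⟨l, ⟨⟨ha, hb⟩, ha', hb'⟩, hl⟩ := (((hs (κ / 2) (half_pos hκ)).and
    (hs' (κ / 2) (half_pos hκ))).and (Ioo_mem_nhdsGT one_pos)).exists
  have hle : ENNReal.ofReal (T + T') ≤ ENNReal.ofReal
      (T - l * (β - κ / 2) + l * D.toReal + (T' - l * (β' - κ / 2))) := by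
    have hlD : 0 ≤ l * D.toReal := mul_nonneg hl.1.le ENNReal.toReal_nonneg
    rw [ENNReal.ofReal_add (add_nonneg ha hlD) ha', ENNReal.ofReal_add ha hlD,
      ENNReal.ofReal_mul hl.1.le, ENNReal.ofReal_toReal hD, ← he]
    refine (edist_triangle4 _ _ (S.proj j' (AffineMap.lineMap p₂ q' l)) _).trans
      (add_le_add (add_le_add hb ?_) ?_)
    · exact h3 l ⟨hl.1.le, hl.2.le⟩
    · rwa [edist_comm]
  rw [ENNReal.ofReal_le_ofReal_iff (by
    have := mul_nonneg hl.1.le (ENNReal.toReal_nonneg (a := D)); linarith)] at hle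
  have : l * (β + β') ≤ l * (D.toReal + κ) := by linarith
  exact le_of_mul_le_mul_left this hl.1

lemma hasSide_of_dir {x e z : X} {T : ℝ} {j : S.ι} {p q u : S.V j} (hp : p ∈ S.cell j)
    (hq : q ∈ S.cell j) (hx : S.proj j p = x) (hz : S.proj j q = z) (hd : dist q p < r / 3)
    (hu : ‖u‖ = 1) (hT : 0 < T) (he : p + T • u ∈ S.cell j) (he' : S.proj j (p + T • u) = e) :
    S.HasSide r x e T z (fderiv ℝ (fun x : S.V j => ‖x‖) u (q - p)) := by
  refine ⟨j, p, q, hp, hq, hx, hz, hd, fun κ hκ => ?_⟩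
  filter_upwards [eventually_norm_smul_sub_le (v := q - p) (differentiableAt_norm hu) hu hT hκ,
    Ioo_mem_nhdsGT one_pos] with l hl hl1
  refine ⟨(norm_nonneg _).trans hl, ?_⟩
  rw [← he']
  refine (edist_proj_le he (lineMap_mem_cell hp hq ⟨hl1.1.le, hl1.2.le⟩)).trans ?_
  rw [edist_dist]
  refine ENNReal.ofReal_le_ofReal (le_trans (le_of_eq ?_) hl)
  rw [dist_eq_norm, AffineMap.lineMap_apply, vsub_eq_sub, vadd_eq_add]
  congr 1
  abel

/-- The point `z` near `γ t` is ahead of `γ t` by `v` to first order. At the ends of `γ` only the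
end point itself is allowed. -/
def HasOffset (S : Space.{u, v, w} X) (γ : ℝ → X) (L η t : ℝ) (z : X) (v : ℝ) : Prop :=
  ((t = 0 ∨ t = L) ∧ z = γ t ∧ v = 0) ∨
    (0 < t ∧ t < L ∧ ∃ (j : S.ι) (y q u : S.V j), y ∈ S.cell j ∧ q ∈ S.cell j ∧
      S.proj j y = γ t ∧ S.proj j q = z ∧ edist y q = edist (γ t) z ∧ S.IsDir γ η t j y u ∧
      v = fderiv ℝ (fun x : S.V j => ‖x‖) u (q - y))

lemma exists_hasOffset {η t : ℝ} (ht : t ∈ Ioo 0 L) (hreg : S.IsRegularAt γ η t) :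
    ∃ ε > 0, ∀ z, edist (γ t) z < ENNReal.ofReal ε → ∃ v, S.HasOffset γ L η t z v := by
  obtain ⟨ρ, hρ⟩ := S.exists_isConeRadius (γ t)
  refine ⟨ρ, hρ.pos, fun z hz => ?_⟩
  obtain ⟨j, q, hq, rfl⟩ := S.exists_proj_eq z
  obtain ⟨y, hy, hyt, hyq⟩ := exists_apex_of_edist_lt hρ hq hz
  obtain ⟨u, hu⟩ := hreg j y hy hyt
  exact ⟨_, Or.inr ⟨ht.1, ht.2, j, y, q, u, hy, hq, hyt, rfl, hyq, hu, rfl⟩⟩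

lemma IsDir.hasOffset {η t : ℝ} (ht : t ∈ Ioo 0 L) {j : S.ι} {y u : S.V j}
    (hu : S.IsDir γ η t j y u) {h : ℝ} (hh : |h| < η)
    (hd : edist (γ t) (γ (t + h)) = ENNReal.ofReal |h|) :
    S.HasOffset γ L η t (γ (t + h)) h := by
  have hη : |(0 : ℝ)| < η := by rw [abs_zero]; exact (abs_nonneg h).trans_lt hh
  refine Or.inr ⟨ht.1, ht.2, j, y, y + h • u, u, by simpa using hu.mem 0 hη, hu.mem h hh,
    by simpa using hu.proj_eq 0 hη, hu.proj_eq h hh, ?_, hu, ?_⟩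
  · rw [hd, edist_dist, dist_self_add_right, norm_smul, hu.norm_eq, mul_one, Real.norm_eq_abs]
  · rw [add_sub_cancel_left, map_smul, (differentiableAt_norm hu.norm_eq).fderiv_norm_self,
      hu.norm_eq, smul_eq_mul, mul_one]

/-- One cell contains lifts of `z`, `γ s` and `γ c`. Seen from `γ c` the direction is `-u`, and the
differential of the norm is odd in its base point, whence the rate `c - s - v`. The lift of `z` is
within `2 * δ ≤ r / 3` of the apex. At `s = c = 0` the side degenerates to `T = 0`. -/
lemma exists_hasSide_left (hr : S.IsConeRadius (γ c) r) (hδr : 6 * δ ≤ r)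
    (hγ : IsIsometricNear γ L c δ) (hδ : 0 < δ) (hc : c ∈ Icc 0 L) {s η v : ℝ} {z : X} (hη : 0 < η)
    (hs : (0 < s ∧ s < c) ∨ (s = 0 ∧ c = 0)) (hsδ : c - δ < s)
    (hoff : S.HasOffset γ L η s z v) (hz : edist (γ s) z < ENNReal.ofReal δ) :
    ∃ T, 0 ≤ T ∧ T < δ ∧ c - T ∈ Icc 0 L ∧ S.HasSide r (γ c) (γ (c - T)) T z (c - s - v) := by
  rcases hs with ⟨hs0, hsc⟩ | ⟨rfl, rfl⟩
  · obtain ⟨h | h, -, -⟩ | ⟨-, hsL, j, y, q, u, hy, hq, hyt, hqz, hyq, hu, rfl⟩ := hoff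
    · exact absurd h hs0.ne'
    · linarith [hc.2]
    obtain ⟨η', h1, h2, h3⟩ := exists_dir_left hr (by linarith) hγ hc.2 hsc hsδ hs0
    obtain ⟨u', hu', hu''⟩ := h3 j y hy hyt
    have hdir : S.IsDir γ η' s j y u' := by
      have : ∀ h, |h| < η' → h ∈ Ioc (-η') (c - s) := fun h hh => by
        rw [abs_lt] at hh; exact ⟨hh.1, by linarith⟩
      exact ⟨hu', fun h hh => (hu'' h (this h hh)).1, fun h hh => (hu'' h (this h hh)).2⟩
    obtain rfl : u = u' := hu.unique hη h1 hdir
    obtain ⟨h4, h5⟩ := hu'' (c - s) ⟨by linarith, le_rfl⟩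
    rw [add_sub_cancel] at h5
    have hyq' : dist y q < δ := by
      rw [← hyq, edist_dist] at hz
      exact (ENNReal.ofReal_lt_ofReal_iff hδ).1 hz
    have hT : y + (c - s) • u + (c - s) • -u = y := by simp
    refine ⟨c - s, by linarith, by linarith, ⟨by linarith, by linarith⟩, ?_⟩
    have := hasSide_of_dir (S := S) (r := r) (x := γ c) (e := γ (c - (c - s))) (z := z)
      (T := c - s) (p := y + (c - s) • u) (q := q) (u := -u) h4 hq h5 hqz ?_ (by rwa [norm_neg])
      (by linarith) (by rwa [hT]) (by rw [hT, hyt]; congr 1; ring)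
    · convert this using 1
      have hn : fderiv ℝ (fun x : S.V j => ‖x‖) (-u) = -fderiv ℝ (fun x : S.V j => ‖x‖) u := by
        have := fderiv_norm_smul_neg (E := S.V j) (x := u) (t := -1) (by norm_num)
        rwa [neg_one_smul] at this
      rw [hn, neg_apply, ← sub_sub, map_sub _ (q - y), map_smul,
        (differentiableAt_norm hu').fderiv_norm_self, hu', smul_eq_mul, mul_one, neg_sub]
    · calc dist q (y + (c - s) • u) ≤ dist q y + dist y (y + (c - s) • u) := dist_triangle _ _ _
        _ < δ + (c - s) := by
          rw [dist_self_add_right, norm_smul, hu', mul_one, Real.norm_of_nonneg (by linarith),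
            dist_comm]
          linarith
        _ ≤ r / 3 := by linarith
  · obtain ⟨-, rfl, rfl⟩ | ⟨h, -⟩ := hoff
    · obtain ⟨j, p, hp, hx⟩ := S.exists_proj_eq (γ 0)
      refine ⟨0, le_rfl, hδ, by simpa using hc, j, p, p, hp, hp, hx, hx, ?_, fun κ hκ => ?_⟩
      · rw [dist_self]; linarith [hr.pos]
      · filter_upwards [self_mem_nhdsWithin] with l hl
        have : (0 : ℝ) < l := hl
        refine ⟨by simp; positivity, ?_⟩
        simp [hx]
    · exact absurd h (lt_irrefl _)

/-- The mirror image, with direction `u`. The final implication is the equality case: if `z` is no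
farther from `γ c` than the rate, the norm and its differential agree on `q - p`, so the radius to
`z` runs along `γ`. -/
lemma exists_hasSide_right (hr : S.IsConeRadius (γ c) r) (hδr : 6 * δ ≤ r)
    (hγ : IsIsometricNear γ L c δ) (hδ : 0 < δ) (hc : c ∈ Icc 0 L) {t η v : ℝ} {z : X} (hη : 0 < η)
    (ht0 : 0 < t) (hct : c ≤ t) (ht : t < L ∨ (t = L ∧ c = L)) (htδ : t < c + δ)
    (hoff : S.HasOffset γ L η t z v) (hz : edist (γ t) z < ENNReal.ofReal (min δ η)) :
    ∃ T, 0 ≤ T ∧ T < δ ∧ c + T ∈ Icc 0 L ∧ S.HasSide r (γ c) (γ (c + T)) T z (t - c + v) ∧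
      (edist (γ c) z ≤ ENNReal.ofReal (t - c + v) → 0 ≤ t - c + v ∧
        ∃ (j : S.ι) (p q : S.V j), p ∈ S.cell j ∧ q ∈ S.cell j ∧ S.proj j p = γ c ∧
          S.proj j q = z ∧ dist p q < r ∧ dist p q = t - c + v ∧
          ∀ l ∈ Icc (0 : ℝ) 1, S.proj j (AffineMap.lineMap p q l) = γ (c + l * (t - c + v))) := by
  rcases ht with htL | ⟨rfl, rfl⟩
  · obtain ⟨h | h, -, -⟩ | ⟨-, -, j, y, q, u, hy, hq, hyt, hqz, hyq, hu, rfl⟩ := hoff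
    · exact absurd h ht0.ne'
    · exact absurd h htL.ne
    have hu1 := hu.norm_eq
    have hyq' : dist y q < min δ η := by
      rw [← hyq, edist_dist] at hz
      exact (ENNReal.ofReal_lt_ofReal_iff (lt_min hδ hη)).1 hz
    obtain ⟨hyδ, hyη⟩ := lt_min_iff.1 hyq'
    have hline : ∀ h ∈ Ico (c - t) η, y + h • u ∈ S.cell j ∧ S.proj j (y + h • u) = γ (t + h) := by
      intro h hh
      rcases hct.eq_or_lt with rfl | hct
      · have : |h| < η := abs_lt.2 ⟨by linarith [hh.1], hh.2⟩
        exact ⟨hu.mem h this, hu.proj_eq h this⟩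
      obtain ⟨η', h1, h2, h3⟩ := exists_dir_right hr (by linarith) hγ hc.1 hct htδ htL
      obtain ⟨u', hu', hu''⟩ := h3 j y hy hyt
      have hdir : S.IsDir γ η' t j y u' := by
        have : ∀ h, |h| < η' → h ∈ Ico (c - t) η' := fun h hh => by
          rw [abs_lt] at hh; exact ⟨by linarith, hh.2⟩
        exact ⟨hu', fun h hh => (hu'' h (this h hh)).1, fun h hh => (hu'' h (this h hh)).2⟩
      obtain rfl : u = u' := hu.unique hη h1 hdir
      rcases lt_or_ge h 0 with h0 | h0
      · exact hu'' h ⟨hh.1, h0.trans h1⟩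
      · have : |h| < η := by rw [abs_of_nonneg h0]; exact hh.2
        exact ⟨hu.mem h this, hu.proj_eq h this⟩
    set p := y + (c - t) • u with hp
    have hpl : ∀ h, p + h • u = y + (c - t + h) • u := fun h => by rw [hp]; module
    obtain ⟨hpc, hpx⟩ := hline (c - t) ⟨le_rfl, by linarith⟩
    rw [add_sub_cancel] at hpx
    have hpq : dist q p ≤ dist y q + (t - c) := by
      calc dist q p ≤ dist q y + dist y p := dist_triangle _ _ _
        _ = dist y q + (t - c) := by
          rw [hp, dist_self_add_right, norm_smul, hu1, mul_one, dist_comm, Real.norm_eq_abs,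
            abs_sub_comm, abs_of_nonneg (by linarith)]
    have hd3 : dist q p < r / 3 := by linarith
    -- For `c < t` the far point is `γ t`. For `c = t` a short step ahead along the line of `γ`
    -- replaces it, which is possible since `t < L`.
    have hT : ∃ T, 0 < T ∧ T < δ ∧ c + T ≤ L ∧ c - t + T < η := by
      refine ⟨if c = t then min (min δ η) (L - c) / 2 else t - c, ?_⟩
      split_ifs with h
      · have h1 : 0 < min (min δ η) (L - c) := lt_min (lt_min hδ hη) (by linarith)
        have h2 : min (min δ η) (L - c) ≤ L - c := min_le_right _ _
        have h3 : min (min δ η) (L - c) ≤ min δ η := min_le_left _ _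
        have h4 := min_le_left δ η
        have h5 := min_le_right δ η
        refine ⟨by linarith, by linarith, by linarith, by linarith⟩
      · have := hct.lt_of_ne h
        refine ⟨by linarith, by linarith, by linarith, by linarith⟩
    obtain ⟨T, hT0, hTδ, hTL, hTη⟩ := hT
    obtain ⟨h4, h5⟩ := hline (c - t + T) ⟨by linarith, hTη⟩
    rw [← hpl] at h4 h5
    have hβ : fderiv ℝ (fun x : S.V j => ‖x‖) u (q - p) =
        t - c + fderiv ℝ (fun x : S.V j => ‖x‖) u (q - y) := by
      rw [hp, ← sub_sub, map_sub _ (q - y), map_smul,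
        (differentiableAt_norm hu1).fderiv_norm_self, hu1, smul_eq_mul]
      ring
    rw [← hβ]
    refine ⟨T, hT0.le, hTδ, ⟨by linarith [hc.1], hTL⟩, ?_, fun hle => ?_⟩
    · exact hasSide_of_dir hpc hq hpx hqz hd3 hu1 hT0 h4 (by rw [h5]; congr 1; ring)
    · have hdr : dist p q < r := by rw [dist_comm]; linarith [hr.pos]
      have hedist := edist_eq_of_dist_lt hr hpc hpx hq hdr
      rw [hqz] at hedist
      rw [hedist, edist_dist] at hle
      have hβ0 : dist p q ≤ fderiv ℝ (fun x : S.V j => ‖x‖) u (q - p) := by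
        by_contra hcon
        rw [not_le] at hcon
        have h6 : 0 < dist p q := by
          rcases (dist_nonneg (x := p) (y := q)).eq_or_lt with h | h
          · have : p = q := dist_eq_zero.1 h.symm
            rw [this] at hcon; simp at hcon
          · exact h
        exact absurd hle (not_le.2 ((ENNReal.ofReal_lt_ofReal_iff h6).2 hcon))
      have hnorm : dist p q = ‖q - p‖ := by rw [dist_comm, dist_eq_norm]
      have hqp := eq_smul_of_norm_le_fderiv (differentiableAt_norm hu1) hu1 (hnorm ▸ hβ0)
      have hβ1 : dist p q = fderiv ℝ (fun x : S.V j => ‖x‖) u (q - p) := by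
        refine le_antisymm hβ0 ?_
        rw [hnorm]
        exact (le_abs_self _).trans (abs_fderiv_norm_le _ _)
      rw [← hβ1]
      refine ⟨dist_nonneg, j, p, q, hpc, hq, hpx, hqz, hdr, rfl, fun l hl => ?_⟩
      have : AffineMap.lineMap p q l = p + (l * dist p q) • u := by
        rw [AffineMap.lineMap_apply, vsub_eq_sub, vadd_eq_add, hqp, smul_smul, add_comm, hnorm]
      have hld : l * dist p q ≤ dist p q := mul_le_of_le_one_left dist_nonneg hl.2
      rw [dist_comm q p] at hpq
      rw [this, hpl, (hline _ ⟨?_, ?_⟩).2]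
      · congr 1; ring
      · have := mul_nonneg hl.1 (dist_nonneg (x := p) (y := q))
        linarith
      · linarith
  · obtain ⟨-, rfl, rfl⟩ | ⟨-, h, -⟩ := hoff
    · obtain ⟨j, p, hp, hx⟩ := S.exists_proj_eq (γ c)
      have hr0 := hr.pos
      refine ⟨0, le_rfl, hδ, by simpa using hc, ⟨j, p, p, hp, hp, hx, hx, ?_, fun κ hκ => ?_⟩,
        fun _ => ⟨by simp, j, p, p, hp, hp, hx, hx, by simpa using hr0, by simp, fun l hl => ?_⟩⟩
      · rw [dist_self]; linarith
      · filter_upwards [self_mem_nhdsWithin] with l hl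
        have : (0 : ℝ) < l := hl
        refine ⟨by simp; positivity, ?_⟩
        simp [hx]
      · simp [hx]
    · exact absurd h (lt_irrefl _)

end Space

/-! ### Non-branching at regular points -/

namespace Space

open FinslerPL.Complex

variable {X : Type u} [EMetricSpace X] {S : Space.{u, v, w} X} {γ : ℝ → X} {L c δ r : ℝ}

/-- Shortest paths do not branch at regular points. -/
lemma eq_of_additive_of_isRegularAt {σ : ℝ → X} {a b m s₀ ℓ : ℝ} (hm : m < s₀)
    (hγc : ContinuousOn γ (Icc m ℓ))
    (hγ : ∀ s ∈ Icc m ℓ, edist (γ m) (γ s) = ENNReal.ofReal (s - m))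
    (hreg : ∀ t ∈ Ico s₀ ℓ, ∃ η > 0, S.IsRegularAt γ η t)
    (hσ : ContinuousOn σ (Icc a b)) {D : ℝ → ℝ} (hDc : ContinuousOn D (Icc a b))
    (hDm : MonotoneOn D (Icc a b))
    (hD : ∀ s ∈ Icc a b, edist (γ m) (σ s) = ENNReal.ofReal (D s - m))
    (hDd : ∀ s ∈ Icc a b, ∀ t ∈ Icc a b, s ≤ t → edist (σ s) (σ t) ≤ ENNReal.ofReal (D t - D s))
    (ha : σ a = γ s₀) (hDa : D a = s₀) :
    ∀ s ∈ Icc a b, D s ≤ ℓ → σ s = γ (D s) := by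
  have hDs₀ : ∀ s ∈ Icc a b, s₀ ≤ D s := fun s hs => by
    rw [← hDa]; exact hDm ⟨le_rfl, hs.1.trans hs.2⟩ hs hs.1
  refine real_induction fun t ht ih => ?_
  have hPt : D t ≤ ℓ → σ t = γ (D t) := by
    intro hle
    rcases ht.1.eq_or_lt with rfl | hat
    · rw [ha, hDa]
    have : (𝓝[Ico a t] t).NeBot := by
      rw [← mem_closure_iff_nhdsWithin_neBot, closure_Ico hat.ne]
      exact ⟨hat.le, le_rfl⟩
    have hsub : Ico a t ⊆ Icc a b := fun s hs => ⟨hs.1, hs.2.le.trans ht.2⟩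
    have hDle : ∀ s ∈ Ico a t, D s ≤ ℓ := fun s hs => (hDm (hsub hs) ht hs.2.le).trans hle
    have h1 : Filter.Tendsto σ (𝓝[Ico a t] t) (𝓝 (σ t)) := (hσ t ht).mono hsub
    have h2 : Filter.Tendsto (fun s => γ (D s)) (𝓝[Ico a t] t) (𝓝 (γ (D t))) := by
      have h3 : Filter.Tendsto D (𝓝[Ico a t] t) (𝓝[Icc m ℓ] (D t)) := by
        refine tendsto_nhdsWithin_iff.2 ⟨(hDc t ht).mono hsub, ?_⟩
        filter_upwards [self_mem_nhdsWithin] with s hs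
        exact ⟨hm.le.trans (hDs₀ s (hsub hs)), hDle s hs⟩
      exact (hγc (D t) ⟨hm.le.trans (hDs₀ t ht), hle⟩).tendsto.comp h3
    refine tendsto_nhds_unique_of_eventuallyEq h1 h2 ?_
    filter_upwards [self_mem_nhdsWithin] with s hs using ih s hs (hDle s hs)
  rcases lt_or_ge (D t) ℓ with hlt | hge
  swap
  · refine ⟨1, one_pos, fun s hs hts _ hle => ?_⟩
    have h1 := hDm ht hs hts
    have h2 := hDd t ht s hs hts
    have h3 : D s = D t := by linarith
    rw [h3, sub_self, ENNReal.ofReal_zero] at h2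
    rw [h3, ← hPt (h3 ▸ hle)]
    exact (edist_le_zero.1 h2).symm
  obtain ⟨η₀, hη₀, hdir⟩ := hreg (D t) ⟨hDs₀ t ht, hlt⟩
  obtain ⟨ρ, hρ⟩ := S.exists_isConeRadius (σ t)
  obtain ⟨η, hη, hcont⟩ := exists_delta_of_continuousOn hσ ht (lt_min hρ.pos hη₀)
  refine ⟨η, hη, fun s hs hts hlt' hle => ?_⟩
  have hc := hcont s hs (by rw [abs_of_nonneg (sub_nonneg.2 hts)]; linarith)
  obtain ⟨j, q, hq, hqs⟩ := S.exists_proj_eq (σ s)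
  obtain ⟨y, hy, hyt, hyq⟩ := exists_apex_of_edist_lt hρ hq (by
    rw [hqs]; exact hc.trans_le (ENNReal.ofReal_le_ofReal (min_le_left _ _)))
  rw [hqs] at hyq
  obtain ⟨u, hu⟩ := hdir j y hy (hyt.trans (hPt hlt.le))
  have hyη : dist y q < η₀ := by
    rw [← hyq, edist_dist] at hc
    exact ((ENNReal.ofReal_lt_ofReal_iff (lt_min hρ.pos hη₀)).1 hc).trans_le (min_le_right _ _)
  have hDts := hDm ht hs hts
  have hD1 : dist y q ≤ D s - D t := by
    have := hDd t ht s hs hts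
    rwa [← hyq, edist_dist, ENNReal.ofReal_le_ofReal_iff (by linarith)] at this
  have hmt : m < D t := hm.trans_le (hDs₀ t ht)
  -- Step back by `h` along `γ` to `y'`. The distance from `γ m` to `σ s` forces `d(y', q) = d(y',
  -- y) + d(y, q)`, so strict convexity puts `q` on the line of direction `u`.
  set h := min (η₀ / 2) (D t - m) with hh
  have hh0 : 0 < h := lt_min (half_pos hη₀) (by linarith)
  have hh1 : h ≤ η₀ / 2 := min_le_left _ _
  have hh2 : h ≤ D t - m := min_le_right _ _
  have habs : |(-h)| < η₀ := by rw [abs_neg, abs_of_pos hh0]; linarith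
  have h1 := hu.mem _ habs
  have h2 := hu.proj_eq _ habs
  set y' := y + (-h) • u with hy'
  have h3 : D s - D t + h ≤ dist y' q := by
    have h4 : edist (γ (D t + -h)) (σ s) ≤ edist y' q := by
      rw [← h2, ← hqs]; exact edist_proj_le h1 hq
    have h5 : edist (γ m) (σ s) ≤ ENNReal.ofReal (D t + -h - m) + ENNReal.ofReal (dist y' q) := by
      refine (edist_triangle _ (γ (D t + -h)) _).trans (add_le_add (hγ _ ⟨?_, ?_⟩).le ?_)
      · linarith
      · linarith
      · rwa [edist_dist] at h4
    rw [hD s hs, ← ENNReal.ofReal_add (by linarith) dist_nonneg,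
      ENNReal.ofReal_le_ofReal_iff (by have := dist_nonneg (x := y') (y := q); linarith)] at h5
    linarith
  have h4 : dist y' y = h := by
    rw [hy', dist_comm, dist_self_add_right, norm_smul, hu.norm_eq, mul_one, norm_neg,
      Real.norm_of_nonneg hh0.le]
  have h5 := dist_triangle y' y q
  have h6 : dist y q = D s - D t := by linarith
  have h7 : dist y' q = h + dist y q := by linarith
  obtain ⟨k, hk, hky⟩ := dist_add_dist_eq_iff.1 (show dist y' y + dist y q = dist y' q by
    rw [h4, h7])
  have h8 : k * dist y' q = h := by
    rw [← h4, ← hky, dist_left_lineMap, Real.norm_of_nonneg hk.1]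
  have hq' : q = y + (dist y q) • u := by
    have hk0 : 0 < k := by
      rcases hk.1.eq_or_lt with h | h
      · rw [← h, zero_mul] at h8; linarith
      · exact h
    have h9 : k • (q - y') = h • u := by
      have : AffineMap.lineMap y' q k - y' = y - y' := by rw [hky]
      rw [AffineMap.lineMap_apply, vsub_eq_sub, vadd_eq_add, add_sub_cancel_right] at this
      rw [this, hy']
      module
    have h10 : k • (q - y') = k • ((h + dist y q) • u) := by
      rw [h9, smul_smul, ← h7, h8]
    have h11 := smul_right_injective _ hk0.ne' h10
    calc q = y' + (q - y') := by abel
      _ = y + dist y q • u := by rw [show q - y' = (h + dist y q) • u from h11, hy']; module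
  rw [← hqs, hq', hu.proj_eq _ (by rwa [abs_of_nonneg dist_nonneg]), h6]
  congr 1; ring

lemma len_add {σ : ℝ → X} {a b c : ℝ} (hab : a ≤ b) (hbc : b ≤ c) :
    len σ a b + len σ b c = len σ a c := by
  simpa [len] using eVariationOn.Icc_add_Icc (s := univ) σ hab hbc (mem_univ b)

lemma edist_le_len {σ : ℝ → X} {a b s t : ℝ} (hs : s ∈ Icc a b) (ht : t ∈ Icc a b) :
    edist (σ s) (σ t) ≤ len σ a b :=
  eVariationOn.edist_le _ hs ht

lemma len_mono {σ : ℝ → X} {a b a' b' : ℝ} (ha : a ≤ a') (hb : b' ≤ b) :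
    len σ a' b' ≤ len σ a b :=
  eVariationOn.mono _ (Icc_subset_Icc ha hb)

end Space

/-! ### The lower bound across `γ c` and its equality case -/

namespace Space

open FinslerPL.Complex

variable {X : Type u} [EMetricSpace X]

/-- Minimality passes to subarcs: a strict loss on `[s, t]` would survive adding the two outer
lengths, which are finite. -/
lemma edist_eq_len_of_len_le {σ : ℝ → X} {a b : ℝ} (h : len σ a b ≤ edist (σ a) (σ b))
    (hfin : edist (σ a) (σ b) ≠ ⊤) {s t : ℝ} (has : a ≤ s) (hst : s ≤ t) (htb : t ≤ b) :
    edist (σ s) (σ t) = len σ s t := by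
  refine le_antisymm (edist_le_len ⟨le_rfl, hst⟩ ⟨hst, le_rfl⟩) ?_
  by_contra hcon
  rw [not_le] at hcon
  have h1 : edist (σ a) (σ b) ≤ len σ a s + edist (σ s) (σ t) + len σ t b :=
    (edist_triangle4 _ (σ s) (σ t) _).trans (add_le_add (add_le_add
      (edist_le_len ⟨le_rfl, has⟩ ⟨has, le_rfl⟩) le_rfl) (edist_le_len ⟨le_rfl, htb⟩ ⟨htb, le_rfl⟩))
  have h2 : len σ a s + len σ s t + len σ t b = len σ a b := by
    rw [len_add has hst, len_add (has.trans hst) htb]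
  have hf : len σ a b ≠ ⊤ := (h.trans_lt hfin.lt_top).ne
  have h3 : len σ a s ≠ ⊤ := ((len_mono le_rfl (hst.trans htb)).trans_lt hf.lt_top).ne
  have h4 : len σ t b ≠ ⊤ := ((len_mono (has.trans hst) le_rfl).trans_lt hf.lt_top).ne
  have h5 : len σ a s + edist (σ s) (σ t) + len σ t b < len σ a b := by
    rw [← h2]
    exact ENNReal.add_lt_add_right h4 (ENNReal.add_lt_add_left h3 hcon)
  exact absurd (h.trans h1) (not_le.2 h5)

lemma toReal_len_add {σ : ℝ → X} {a b c : ℝ} (hab : a ≤ b) (hbc : b ≤ c) (h : len σ a c ≠ ⊤) :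
    (len σ a c).toReal = (len σ a b).toReal + (len σ b c).toReal := by
  rw [← len_add hab hbc] at h ⊢
  rw [ENNReal.toReal_add]
  · exact (le_self_add.trans_lt h.lt_top).ne
  · exact (le_add_self.trans_lt h.lt_top).ne

variable {S : Space.{u, v, w} X} {γ : ℝ → X} {L c δ r : ℝ}

lemma HasOffset.ofReal_abs_le {η t v : ℝ} {z : X} (h : S.HasOffset γ L η t z v) :
    ENNReal.ofReal |v| ≤ edist (γ t) z := by
  obtain ⟨-, -, rfl⟩ | ⟨-, -, j, y, q, u, -, -, -, -, h1, -, rfl⟩ := h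
  · simp
  · rw [← h1, edist_dist, dist_comm, dist_eq_norm]
    exact ENNReal.ofReal_le_ofReal (abs_fderiv_norm_le _ _)

lemma HasOffset.abs_lt {η t v ε : ℝ} {z : X} (h : S.HasOffset γ L η t z v)
    (hz : edist (γ t) z < ENNReal.ofReal ε) : |v| < ε :=
  ENNReal.ofReal_lt_ofReal_iff_of_nonneg (abs_nonneg v) |>.1 (h.ofReal_abs_le.trans_lt hz)

lemma IsIsometricNear.edist_eq (hγ : IsIsometricNear γ L c δ) {s t : ℝ} (hs0 : 0 ≤ s)
    (hst : s ≤ t) (htL : t ≤ L) (hs : c - δ < s) (ht : t < c + δ) :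
    edist (γ s) (γ t) = ENNReal.ofReal (t - s) := by
  rw [hγ s ⟨hs0, hst.trans htL⟩ t ⟨hs0.trans hst, htL⟩ (by rw [abs_lt]; constructor <;> linarith)
    (by rw [abs_lt]; constructor <;> linarith), abs_sub_comm,
    abs_of_nonneg (sub_nonneg.2 hst)]

/-- The first order lower bound for the distance between points on two sides of `γ c`. -/
lemma le_edist_of_hasOffset (hr : S.IsConeRadius (γ c) r) (hδr : 6 * δ ≤ r)
    (hγ : IsIsometricNear γ L c δ) (hδ : 0 < δ) (hc : c ∈ Icc 0 L) {s t η η' v v' : ℝ} {z z' : X}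
    (hη : 0 < η) (hη' : 0 < η') (hs : (0 < s ∧ s < c) ∨ (s = 0 ∧ c = 0)) (hsδ : c - δ < s)
    (ht0 : 0 < t) (hct : c ≤ t) (ht : t < L ∨ (t = L ∧ c = L)) (htδ : t < c + δ)
    (hoff : S.HasOffset γ L η s z v) (hz : edist (γ s) z < ENNReal.ofReal δ)
    (hoff' : S.HasOffset γ L η' t z' v') (hz' : edist (γ t) z' < ENNReal.ofReal (min δ η')) :
    ENNReal.ofReal (t + v' - (s + v)) ≤ edist z z' := by
  obtain ⟨T, h1, h2, h3, h4⟩ := exists_hasSide_left hr hδr hγ hδ hc hη hs hsδ hoff hz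
  obtain ⟨T', h1', h2', h3', h4', -⟩ :=
    exists_hasSide_right hr hδr hγ hδ hc hη' ht0 hct ht htδ hoff' hz'
  have := h4.add_le hr h4' (by
    rw [hγ.edist_eq h3.1 (by linarith) h3'.2 (by linarith) (by linarith)]
    congr 1; ring)
  convert this using 2
  ring

/-- After passing through `γ c`, a curve of minimal length follows `γ`. -/
lemma eq_of_len_le_after (hr : S.IsConeRadius (γ c) r) (hδr : 6 * δ ≤ r)
    (hγ : IsIsometricNear γ L c δ) (hδ : 0 < δ) (hc : c ∈ Icc 0 L) {t η v : ℝ}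
    (hη : 0 < η) (ht0 : 0 < t) (hct : c ≤ t) (ht : t < L ∨ (t = L ∧ c = L)) (htδ : t < c + δ)
    {σ : ℝ → X} {s₁ t₁ : ℝ} (hst : s₁ ≤ t₁) (hσ : ContinuousOn σ (Icc s₁ t₁))
    (hoff : S.HasOffset γ L η t (σ t₁) v) (hz : edist (γ t) (σ t₁) < ENNReal.ofReal (min δ η))
    {D : ℝ → ℝ} (hDm : MonotoneOn D (Icc s₁ t₁))
    (hDd : ∀ s ∈ Icc s₁ t₁, ∀ s' ∈ Icc s₁ t₁, s ≤ s' →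
      edist (σ s) (σ s') = ENNReal.ofReal (D s' - D s))
    (hs : σ s₁ = γ c) (hDs : D s₁ = c) (hDt : D t₁ = t + v) :
    ∀ s ∈ Icc s₁ t₁, σ s = γ (D s) := by
  intro s hs'
  have ha : s₁ ∈ Icc s₁ t₁ := ⟨le_rfl, hst⟩
  have hb : t₁ ∈ Icc s₁ t₁ := ⟨hst, le_rfl⟩
  obtain ⟨T, -, -, -, -, h⟩ :=
    exists_hasSide_right hr hδr hγ hδ hc hη ht0 hct ht htδ hoff hz
  have hedist : ∀ s ∈ Icc s₁ t₁, edist (γ c) (σ s) = ENNReal.ofReal (D s - c) := fun s hs' => by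
    rw [← hs, hDd s₁ ha s hs' hs'.1, hDs]
  -- The length puts `σ t₁` in the equality case, so the radius to it is part of `γ`; being shortest
  -- from the apex, `σ` follows this radius.
  obtain ⟨hβ, j, p, q, hp, hq, hx, hqz, hd, hpq, hline⟩ := h (by
    rw [hedist t₁ hb, hDt]; exact ENNReal.ofReal_le_ofReal (by linarith))
  have hDc : ∀ s ∈ Icc s₁ t₁, c ≤ D s := fun s hs' => by rw [← hDs]; exact hDm ha hs' hs'.1
  have key := eq_proj_lineMap_of_additive hr hσ (fun s hs s' hs' hss => by
    have h1 := hDc s hs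
    have h2 := hDm hs hs' hss
    rw [hedist s hs, hedist s' hs', hDd s hs s' hs' hss, ← ENNReal.ofReal_add (by linarith)
      (by linarith)]
    congr 1; ring) hp hx hq hqz hd hs'
  have h1 := hDc s hs'
  have h2 := hDm hs' hb hs'.2
  rw [hedist s hs', hedist t₁ hb, ENNReal.toReal_ofReal (by linarith),
    ENNReal.toReal_ofReal (by linarith)] at key
  have h3 : t - c + v = D t₁ - c := by linarith
  rw [key, hline _ ⟨div_nonneg (by linarith) (by linarith), div_le_one_of_le₀ (by linarith)
    (by linarith)⟩, h3]
  congr 1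
  rcases eq_or_ne (D t₁ - c) 0 with h0 | h0
  · rw [h0]; linarith
  · field_simp
    ring

lemma continuousOn_toReal_len {σ : ℝ → X} {s t : ℝ} (hσ : ContinuousOn σ (Icc s t))
    (hle : len σ s t ≤ edist (σ s) (σ t)) (hfin : len σ s t ≠ ⊤) :
    ContinuousOn (fun τ => (len σ s τ).toReal) (Icc s t) := by
  rcases lt_or_ge t s with hst | hst
  · rw [Icc_eq_empty hst.not_ge]
    exact continuousOn_empty _
  have hfin' : edist (σ s) (σ t) ≠ ⊤ :=
    ((edist_le_len ⟨le_rfl, hst⟩ ⟨hst, le_rfl⟩).trans_lt hfin.lt_top).ne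
  have : ContinuousOn (fun τ => (edist (σ s) (σ τ)).toReal) (Icc s t) := fun τ hτ => by
    refine (ENNReal.tendsto_toReal ?_).comp (tendsto_const_nhds.edist (hσ τ hτ))
    rw [edist_eq_len_of_len_le hle hfin' le_rfl hτ.1 hτ.2]
    exact ((len_mono le_rfl hτ.2).trans_lt hfin.lt_top).ne
  exact this.congr fun τ hτ =>
    congrArg ENNReal.toReal (edist_eq_len_of_len_le hle hfin' le_rfl hτ.1 hτ.2).symm

/-- Distance and length both equal `ℓ`, so arc length measures distances along `σ`. The shift `d`
lets it be compared with the parameter of `γ`. -/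
lemma len_data {σ : ℝ → X} {s t : ℝ} (hst : s ≤ t) (hσ : ContinuousOn σ (Icc s t)) {ℓ d : ℝ}
    (hℓ : 0 ≤ ℓ) (h1 : ENNReal.ofReal ℓ ≤ edist (σ s) (σ t)) (h2 : len σ s t ≤ ENNReal.ofReal ℓ) :
    (∀ a ∈ Icc s t, ∀ b ∈ Icc s t, a ≤ b → edist (σ a) (σ b) =
      ENNReal.ofReal (d + (len σ s b).toReal - (d + (len σ s a).toReal))) ∧
    MonotoneOn (fun τ => d + (len σ s τ).toReal) (Icc s t) ∧
    ContinuousOn (fun τ => d + (len σ s τ).toReal) (Icc s t) ∧ (len σ s t).toReal = ℓ := by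
  have hle : len σ s t ≤ edist (σ s) (σ t) := h2.trans h1
  have hfin : len σ s t ≠ ⊤ := (h2.trans_lt ENNReal.ofReal_lt_top).ne
  have hfin' : edist (σ s) (σ t) ≠ ⊤ :=
    ((edist_le_len ⟨le_rfl, hst⟩ ⟨hst, le_rfl⟩).trans_lt hfin.lt_top).ne
  have hsub : ∀ b ∈ Icc s t, len σ s b ≠ ⊤ := fun b hb =>
    ((len_mono le_rfl hb.2).trans_lt hfin.lt_top).ne
  refine ⟨fun a ha b hb hab => ?_, fun a ha b hb hab => ?_, ?_, ?_⟩
  · rw [edist_eq_len_of_len_le hle hfin' ha.1 hab hb.2, toReal_len_add ha.1 hab (hsub b hb)]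
    have : len σ a b ≠ ⊤ := ((len_mono ha.1 hb.2).trans_lt hfin.lt_top).ne
    rw [show d + ((len σ s a).toReal + (len σ a b).toReal) - (d + (len σ s a).toReal) =
      (len σ a b).toReal by ring, ENNReal.ofReal_toReal this]
  · have := ENNReal.toReal_mono (hsub b hb) (len_mono (σ := σ) (le_refl s) hab)
    simpa using this
  · exact continuousOn_const.add (continuousOn_toReal_len hσ hle hfin)
  · rw [le_antisymm h2 (h1.trans (edist_le_len ⟨le_rfl, hst⟩ ⟨hst, le_rfl⟩)),
      ENNReal.toReal_ofReal hℓ]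

/-- A curve of minimal length that starts on `γ` before `γ c` follows `γ` through `γ c`. -/
lemma exists_eq_of_len_le (hr : S.IsConeRadius (γ c) r) (hδr : 6 * δ ≤ r)
    (hγ : IsIsometricNear γ L c δ) (hδ : 0 < δ) (hc : c ∈ Icc 0 L) (hγc : ContinuousOn γ (Icc 0 L))
    {s t η η' : ℝ} (hη : 0 < η) (hη' : 0 < η') (hreg : S.IsRegularAt γ η s)
    (hs0 : 0 < s) (hsc : s < c) (hsδ : c - δ < s) (hct : c ≤ t) (ht : t < L ∨ (t = L ∧ c = L))
    (htδ : t < c + δ) :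
    ∃ ε > 0, ∀ (σ : ℝ → X) (v v' : ℝ), ContinuousOn σ (Icc s t) →
      edist (γ s) (σ s) < ENNReal.ofReal ε → edist (γ t) (σ t) < ENNReal.ofReal ε →
      S.HasOffset γ L η s (σ s) v → S.HasOffset γ L η' t (σ t) v' →
      ENNReal.ofReal (t + v' - (s + v)) ≤ edist (σ s) (σ t) ∧
      (len σ s t ≤ ENNReal.ofReal (t + v' - (s + v)) → σ s = γ (s + v) →
        ∀ τ ∈ Icc s t, σ τ = γ (s + v + (len σ s τ).toReal)) := by
  have hst : s ≤ t := hsc.le.trans hct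
  have ht0 : 0 < t := hs0.trans_le hst
  -- With `|v| < μ / 4`, both `s + v` and `s + v - μ / 4` stay positive, inside `(c - δ, c)`, and
  -- within `η` of `s`.
  obtain ⟨μ, hμ, hμη, hμs, hμδ, hμc⟩ : ∃ μ > 0, μ ≤ η ∧ μ ≤ s ∧ μ ≤ s - (c - δ) ∧ μ ≤ c - s :=
    ⟨min (min η s) (min (s - (c - δ)) (c - s)),
      lt_min (lt_min hη hs0) (lt_min (by linarith) (by linarith)),
      (min_le_left _ _).trans (min_le_left _ _), (min_le_left _ _).trans (min_le_right _ _),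
      (min_le_right _ _).trans (min_le_left _ _), (min_le_right _ _).trans (min_le_right _ _)⟩
  refine ⟨min (μ / 4) (min δ η'), lt_min (by positivity) (lt_min hδ hη'),
    fun σ v v' hσ hzs hzt hoff hoff' => ?_⟩
  have hv := hoff.abs_lt (hzs.trans_le (ENNReal.ofReal_le_ofReal (min_le_left _ _)))
  have hv' := hoff'.abs_lt (hzt.trans_le (ENNReal.ofReal_le_ofReal (min_le_left _ _)))
  rw [abs_lt] at hv hv'
  have hzt' := hzt.trans_le (ENNReal.ofReal_le_ofReal (min_le_right (μ / 4) _))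
  have h1 := le_edist_of_hasOffset hr hδr hγ hδ hc hη hη' (Or.inl ⟨hs0, hsc⟩) hsδ ht0 hct ht htδ
    hoff (hzs.trans_le (ENNReal.ofReal_le_ofReal ((min_le_right _ _).trans (min_le_left _ _))))
    hoff' hzt'
  refine ⟨h1, fun hlen hσs => ?_⟩
  obtain ⟨hDd, hDm, hDc, hDt⟩ := len_data (d := s + v) hst hσ (by linarith) h1 hlen
  set D : ℝ → ℝ := fun τ => s + v + (len σ s τ).toReal with hD
  replace hDd : ∀ a ∈ Icc s t, ∀ b ∈ Icc s t, a ≤ b →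
    edist (σ a) (σ b) = ENNReal.ofReal (D b - D a) := hDd
  have hDs : D s = s + v := by simp [hD, len]
  have hDt' : D t = t + v' := by simp only [hD]; linarith
  have hsm : s ∈ Icc s t := ⟨le_rfl, hst⟩
  have htm : t ∈ Icc s t := ⟨hst, le_rfl⟩
  have hstart : ∀ τ ∈ Icc s t, D τ ≤ c → σ τ = γ (D τ) := by
    -- `γ m` lies slightly behind `σ s = γ (s + v)`. The lower bound from `γ m` to `σ t` shows that
    -- `σ`, prolonged backwards along `γ`, is still shortest; non-branching needs this.
    set m := s + (v - μ / 4) with hm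
    have hm0 : 0 ≤ m := by linarith
    have hmoff : S.HasOffset γ L η s (γ m) (v - μ / 4) := by
      obtain ⟨j, y, hy, hyt⟩ := S.exists_proj_eq (γ s)
      obtain ⟨u, hu⟩ := hreg j y hy hyt
      refine hu.hasOffset ⟨hs0, by linarith [hc.2]⟩ (by rw [abs_lt]; constructor <;> linarith) ?_
      rw [hγ s ⟨hs0.le, by linarith [hc.2]⟩ _ ⟨hm0, by linarith [hc.2]⟩
        (by rw [abs_lt]; constructor <;> linarith)
        (by rw [abs_lt]; constructor <;> linarith), sub_add_cancel_left, abs_neg]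
    have hmz : edist (γ s) (γ m) < ENNReal.ofReal δ := by
      rw [edist_comm, hγ.edist_eq hm0 (by linarith) (by linarith [hc.2]) (by linarith)
        (by linarith)]
      exact (ENNReal.ofReal_lt_ofReal_iff hδ).2 (by linarith)
    have h2 := le_edist_of_hasOffset hr hδr hγ hδ hc hη hη' (Or.inl ⟨hs0, hsc⟩) hsδ ht0 hct ht htδ
      hmoff hmz hoff' hzt'
    rw [← hm, ← hDt'] at h2
    have hmD : ∀ τ ∈ Icc s t, m < D τ := fun τ hτ => by
      have := hDm hsm hτ hτ.1
      simp only [hDs] at this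
      linarith
    refine eq_of_additive_of_isRegularAt (S := S) (m := m) (s₀ := s + v) (by linarith)
      (hγc.mono (Icc_subset_Icc hm0 hc.2)) (fun τ hτ => ?_) (fun τ hτ => ?_) hσ hDc hDm ?_
      (fun a ha b hb hab => (hDd a ha b hb hab).le) hσs hDs
    · exact hγ.edist_eq hm0 hτ.1 (hτ.2.trans hc.2) (by linarith) (by linarith [hτ.2])
    · exact exists_isRegularAt hr (by linarith) hγ hc hτ.2.ne
        (by rw [abs_lt]; constructor <;> linarith [hτ.1, hτ.2])
        ⟨by linarith [hτ.1], hτ.2.trans_le hc.2⟩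
    · intro τ hτ
      have hup : edist (γ m) (σ τ) ≤ ENNReal.ofReal (D τ - m) := by
        refine (edist_triangle _ (σ s) _).trans ?_
        rw [hDd s hsm τ hτ hτ.1, hσs, hγ.edist_eq hm0 (by linarith) (by linarith [hc.2])
          (by linarith) (by linarith), hDs, ← ENNReal.ofReal_add (by linarith)
          (by have := hDm hsm hτ hτ.1; simp only [hDs] at this; linarith)]
        exact ENNReal.ofReal_le_ofReal (by linarith)
      refine le_antisymm hup ?_
      have hfin : edist (γ m) (σ τ) ≠ ⊤ := (hup.trans_lt ENNReal.ofReal_lt_top).ne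
      have hmt := hDm hτ htm hτ.2
      have h3 := h2.trans (edist_triangle _ (σ τ) _)
      rw [hDd τ hτ t htm hτ.2, ← ENNReal.ofReal_toReal hfin,
        ← ENNReal.ofReal_add ENNReal.toReal_nonneg (sub_nonneg.2 hmt),
        ENNReal.ofReal_le_ofReal_iff (add_nonneg ENNReal.toReal_nonneg (sub_nonneg.2 hmt))] at h3
      rw [ENNReal.ofReal_le_iff_le_toReal hfin]
      linarith
  intro τ hτ
  rcases le_or_gt (D τ) c with hle | hgt
  · exact hstart τ hτ hle
  -- Non-branching stops at `γ c`, which need not be regular. From the time `τ₀` at which `σ`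
  -- reaches it, the equality case of the first variation takes over.
  obtain ⟨τ₀, hτ₀, hDτ₀⟩ := intermediate_value_Icc hτ.1
    (hDc.mono (Icc_subset_Icc le_rfl hτ.2)) ⟨by rw [hDs]; linarith, hgt.le⟩
  have hτ₀' : τ₀ ∈ Icc s t := ⟨hτ₀.1, hτ₀.2.trans hτ.2⟩
  have hsub : Icc τ₀ t ⊆ Icc s t := Icc_subset_Icc hτ₀.1 le_rfl
  refine eq_of_len_le_after hr hδr hγ hδ hc hη' ht0 hct ht htδ hτ₀'.2 (hσ.mono hsub) hoff' hzt'
    (hDm.mono hsub) (fun a ha b hb hab => hDd a (hsub ha) b (hsub hb) hab) ?_ hDτ₀ hDt' τ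
    ⟨hτ₀.2, hτ.2⟩
  rw [hstart τ₀ hτ₀' hDτ₀.le, hDτ₀]

end Space

/-! ### Continuation along the geodesic -/

namespace Space

open FinslerPL.Complex

variable {X : Type u} [EMetricSpace X] {S : Space.{u, v, w} X} {γ : ℝ → X} {L c δ r : ℝ}

lemma exists_radius_near (S : Space.{u, v, w} X)
    (hU : ∀ c ∈ Icc 0 L, ∃ δ > 0, IsIsometricNear γ L c δ) (hc : c ∈ Icc 0 L) :
    ∃ r δ, S.IsConeRadius (γ c) r ∧ 6 * δ ≤ r ∧ 0 < δ ∧ IsIsometricNear γ L c δ := by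
  obtain ⟨δ, hδ, hγ⟩ := hU c hc
  obtain ⟨r, hr⟩ := S.exists_isConeRadius (γ c)
  have hr0 := hr.pos
  refine ⟨r, min δ (r / 6), hr, ?_, lt_min hδ (by positivity), fun s hs t ht hsc htc =>
    hγ s hs t ht (hsc.trans_le (min_le_left _ _)) (htc.trans_le (min_le_left _ _))⟩
  linarith [min_le_right δ (r / 6)]

/-- The comparison of curves near `γ`, up to time `t`. -/
def IsStableUpTo (S : Space.{u, v, w} X) (γ : ℝ → X) (L t : ℝ) : Prop :=
  ∀ η > 0, ∃ ε > 0, ∀ σ : ℝ → X, ContinuousOn σ (Icc 0 L) → σ 0 = γ 0 →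
    (∀ τ ∈ Icc 0 L, edist (γ τ) (σ τ) < ENNReal.ofReal ε) →
    ∀ v, S.HasOffset γ L η t (σ t) v → ENNReal.ofReal (t + v) ≤ len σ 0 t ∧
      (len σ 0 t ≤ ENNReal.ofReal (t + v) →
        (∀ τ ∈ Icc 0 t, σ τ = γ (len σ 0 τ).toReal) ∧
          ContinuousOn (fun τ => (len σ 0 τ).toReal) (Icc 0 t))

lemma isStableUpTo_of_start (hr : S.IsConeRadius (γ 0) r) (hδr : 6 * δ ≤ r)
    (hγ : IsIsometricNear γ L 0 δ) (hδ : 0 < δ) (hL : 0 < L) {t : ℝ} (ht0 : 0 < t) (htL : t < L)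
    (htδ : t < δ) : S.IsStableUpTo γ L t := by
  intro η hη
  refine ⟨min t (min δ η), lt_min ht0 (lt_min hδ hη), fun σ hσ h0 hz v hoff => ?_⟩
  have hL0 : (0 : ℝ) ∈ Icc 0 L := ⟨le_rfl, hL.le⟩
  have hzt := (hz t ⟨ht0.le, htL.le⟩).trans_le (ENNReal.ofReal_le_ofReal (min_le_right t _))
  have hv := hoff.abs_lt ((hz t ⟨ht0.le, htL.le⟩).trans_le
    (ENNReal.ofReal_le_ofReal (min_le_left t _)))
  rw [abs_lt] at hv
  have h1 : ENNReal.ofReal (t + v) ≤ edist (σ 0) (σ t) := by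
    have := le_edist_of_hasOffset (η := 1) (v := 0) (z := σ 0) (s := 0) hr hδr hγ hδ hL0 one_pos hη
      (Or.inr ⟨rfl, rfl⟩) (by linarith) ht0 ht0.le (Or.inl htL) (by linarith)
      (Or.inl ⟨Or.inl rfl, h0, rfl⟩) (by rw [h0, edist_self]; simpa using hδ) hoff hzt
    simpa using this
  refine ⟨h1.trans (edist_le_len ⟨le_rfl, ht0.le⟩ ⟨ht0.le, le_rfl⟩), fun hlen => ?_⟩
  have hσ' := hσ.mono (Icc_subset_Icc le_rfl htL.le)
  obtain ⟨hDd, hDm, hDc, hDt⟩ := len_data (d := 0) ht0.le hσ' (by linarith) h1 hlen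
  simp only [zero_add] at hDd hDm hDc
  refine ⟨?_, hDc⟩
  exact eq_of_len_le_after hr hδr hγ hδ hL0 hη ht0 ht0.le (Or.inl htL) (by linarith) ht0.le hσ'
    hoff hzt hDm hDd h0 (by simp [len]) hDt

/-- The bounds on `[0, s]` and `[s, t]` add up, the offset at `s` cancelling. If the total is
attained, so is each bound, and rigidity on the first part supplies the starting point `σ s = γ (s +
v)` for the second. -/
lemma IsStableUpTo.step (hr : S.IsConeRadius (γ c) r) (hδr : 6 * δ ≤ r)
    (hγ : IsIsometricNear γ L c δ) (hδ : 0 < δ) (hc : c ∈ Icc 0 L) (hγc : ContinuousOn γ (Icc 0 L))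
    {s t : ℝ} (hs : S.IsStableUpTo γ L s) (hs0 : 0 < s) (hsc : s < c) (hsδ : c - δ < s)
    (hct : c ≤ t) (ht : t < L ∨ (t = L ∧ c = L)) (htδ : t < c + δ) : S.IsStableUpTo γ L t := by
  intro η' hη'
  have hst : s ≤ t := hsc.le.trans hct
  have htL : t ≤ L := ht.elim le_of_lt fun h => h.1.le
  have hsL : s ∈ Ioo 0 L := ⟨hs0, hsc.trans_le hc.2⟩
  obtain ⟨η, hη, hreg⟩ := exists_isRegularAt hr (by linarith) hγ hc hsc.ne
    (by rw [abs_lt]; constructor <;> linarith) hsL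
  obtain ⟨ε₁, hε₁, h1⟩ := hs η hη
  obtain ⟨ε₂, hε₂, h2⟩ := exists_eq_of_len_le hr hδr hγ hδ hc hγc hη hη' hreg hs0 hsc hsδ hct ht htδ
  obtain ⟨ε₃, hε₃, h3⟩ := exists_hasOffset (L := L) hsL hreg
  refine ⟨min (min ε₁ ε₂) (min ε₃ s), lt_min (lt_min hε₁ hε₂) (lt_min hε₃ hs0),
    fun σ hσ h0 hz v' hoff' => ?_⟩
  have hle1 : min (min ε₁ ε₂) (min ε₃ s) ≤ ε₁ := (min_le_left _ _).trans (min_le_left _ _)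
  have hle2 : min (min ε₁ ε₂) (min ε₃ s) ≤ ε₂ := (min_le_left _ _).trans (min_le_right _ _)
  have hle3 : min (min ε₁ ε₂) (min ε₃ s) ≤ ε₃ := (min_le_right _ _).trans (min_le_left _ _)
  have hle4 : min (min ε₁ ε₂) (min ε₃ s) ≤ s := (min_le_right _ _).trans (min_le_right _ _)
  have hsm : s ∈ Icc 0 L := ⟨hs0.le, hsL.2.le⟩
  have htm : t ∈ Icc 0 L := ⟨hs0.le.trans hst, htL⟩
  obtain ⟨v, hoff⟩ := h3 (σ s) ((hz s hsm).trans_le (ENNReal.ofReal_le_ofReal hle3))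
  have hv := hoff.abs_lt ((hz s hsm).trans_le (ENNReal.ofReal_le_ofReal hle4))
  rw [abs_lt] at hv
  obtain ⟨h4, h5⟩ := h1 σ hσ h0 (fun τ hτ => (hz τ hτ).trans_le (ENNReal.ofReal_le_ofReal hle1))
    v hoff
  obtain ⟨h6, h7⟩ := h2 σ v v' (hσ.mono (Icc_subset_Icc hs0.le htL))
    ((hz s hsm).trans_le (ENNReal.ofReal_le_ofReal hle2))
    ((hz t htm).trans_le (ENNReal.ofReal_le_ofReal hle2)) hoff hoff'
  have h6' : ENNReal.ofReal (t + v' - (s + v)) ≤ len σ s t :=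
    h6.trans (edist_le_len ⟨le_rfl, hst⟩ ⟨hst, le_rfl⟩)
  have hadd : ENNReal.ofReal (t + v') ≤
      ENNReal.ofReal (s + v) + ENNReal.ofReal (t + v' - (s + v)) := by
    refine le_trans (le_of_eq ?_) ENNReal.ofReal_add_le
    congr 1; ring
  rw [← len_add hs0.le hst]
  refine ⟨hadd.trans (add_le_add h4 h6'), fun hlen => ?_⟩
  have hle := hlen.trans hadd
  have h8 : len σ 0 s ≤ ENNReal.ofReal (s + v) := by
    by_contra hcon
    exact absurd hle (not_le.2 (ENNReal.add_lt_add_of_lt_of_le ENNReal.ofReal_ne_top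
      (not_le.1 hcon) h6'))
  have h9 : len σ s t ≤ ENNReal.ofReal (t + v' - (s + v)) := by
    by_contra hcon
    exact absurd hle (not_le.2 (ENNReal.add_lt_add_of_le_of_lt ENNReal.ofReal_ne_top h4
      (not_le.1 hcon)))
  have hlens : (len σ 0 s).toReal = s + v := by
    rw [le_antisymm h8 h4, ENNReal.toReal_ofReal (by linarith)]
  obtain ⟨h10, h11⟩ := h5 h8
  have hsplit : ∀ τ ∈ Icc s t, (len σ 0 τ).toReal = s + v + (len σ s τ).toReal := fun τ hτ => by
    have hfin : len σ 0 τ ≠ ⊤ := by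
      refine ((len_mono le_rfl hτ.2).trans_lt ?_).ne
      rw [← len_add hs0.le hst]
      exact hlen.trans_lt ENNReal.ofReal_lt_top
    rw [toReal_len_add hs0.le hτ.1 hfin, hlens]
  refine ⟨fun τ hτ => ?_, ?_⟩
  · rcases le_or_gt τ s with hτs | hτs
    · exact h10 τ ⟨hτ.1, hτs⟩
    · rw [hsplit τ ⟨hτs.le, hτ.2⟩]
      exact h7 h9 (by rw [← hlens]; exact h10 s ⟨hs0.le, le_rfl⟩) τ ⟨hτs.le, hτ.2⟩
  · rw [← Icc_union_Icc_eq_Icc hs0.le hst]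
    refine h11.union_of_isClosed ?_ isClosed_Icc isClosed_Icc
    refine (continuousOn_const.add (continuousOn_toReal_len
      (hσ.mono (Icc_subset_Icc hs0.le htL)) (h9.trans h6)
      (h9.trans_lt ENNReal.ofReal_lt_top).ne)).congr hsplit

lemma isStableUpTo_of_unitSpeed (S : Space.{u, v, w} X)
    (hU : ∀ c ∈ Icc 0 L, ∃ δ > 0, IsIsometricNear γ L c δ)
    (hγc : ContinuousOn γ (Icc 0 L)) : ∀ t ∈ Icc 0 L, 0 < t → S.IsStableUpTo γ L t := by
  refine real_induction fun c hc ih => ?_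
  obtain ⟨r, δ, hr, hδr, hδ, hγ⟩ := exists_radius_near S hU hc
  -- The end `L` is reached only from `c = L`: a side of `γ c` with `c < L` needs a direction at
  -- `t`, hence `t < L`.
  obtain ⟨η, hη, hηδ, hηL⟩ : ∃ η > 0, η ≤ δ ∧ (c < L → η ≤ L - c) := by
    rcases hc.2.eq_or_lt with h | h
    · exact ⟨δ, hδ, le_rfl, fun h' => absurd h h'.ne⟩
    · exact ⟨min δ (L - c), lt_min hδ (by linarith), min_le_left _ _, fun _ => min_le_right _ _⟩
  refine ⟨η, hη, fun t ht hct hlt ht0 => ?_⟩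
  have htL : t < L ∨ (t = L ∧ c = L) := by
    rcases hc.2.eq_or_lt with h | h
    · exact Or.inr ⟨le_antisymm ht.2 (h ▸ hct), h⟩
    · have := hηL h
      exact Or.inl (by linarith)
  rcases hc.1.eq_or_lt with rfl | hc0
  · refine isStableUpTo_of_start hr hδr hγ hδ (ht0.trans_le ht.2) ht0 ?_ (by linarith)
    exact htL.resolve_right fun h => by linarith [h.1, h.2]
  · obtain ⟨s, h1, h2⟩ := exists_between (max_lt hc0 (sub_lt_self c hδ))
    rw [max_lt_iff] at h1
    exact (ih s ⟨h1.1.le, h2⟩ h1.1).step hr hδr hγ hδ hc hγc h1.1 h2 h1.2 hct htL (by linarith)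

/-- Stability of unit speed geodesics. -/
lemma exists_stable_of_unitSpeed (S : Space.{u, v, w} X) (hL : 0 < L)
    (hU : ∀ c ∈ Icc 0 L, ∃ δ > 0, IsIsometricNear γ L c δ)
    (hγc : ContinuousOn γ (Icc 0 L)) :
    ∃ ε > 0, ∀ σ : ℝ → X, ContinuousOn σ (Icc 0 L) → σ 0 = γ 0 → σ L = γ L →
      (∀ τ ∈ Icc 0 L, edist (γ τ) (σ τ) < ENNReal.ofReal ε) →
      len σ 0 L ≤ ENNReal.ofReal L → IsReparam σ γ 0 L := by
  obtain ⟨ε, hε, h⟩ := isStableUpTo_of_unitSpeed S hU hγc L ⟨hL.le, le_rfl⟩ hL 1 one_pos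
  refine ⟨ε, hε, fun σ hσ h0 h1 hz hlen => ?_⟩
  obtain ⟨h2, h3⟩ := h σ hσ h0 hz 0 (Or.inl ⟨Or.inr rfl, h1, rfl⟩)
  rw [add_zero] at h2 h3
  have hlenL : len σ 0 L = ENNReal.ofReal L := le_antisymm hlen h2
  have hfin : ∀ τ ∈ Icc 0 L, len σ 0 τ ≠ ⊤ := fun τ hτ =>
    ((len_mono le_rfl hτ.2).trans_lt (hlen.trans_lt ENNReal.ofReal_lt_top)).ne
  obtain ⟨h4, h5⟩ := h3 hlen
  refine ⟨fun τ => (len σ 0 τ).toReal, h5, fun s hs t ht hst => ?_, by simp [len], ?_, h4⟩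
  · exact ENNReal.toReal_mono (hfin t ht) (len_mono le_rfl hst)
  · simp only [hlenL, ENNReal.toReal_ofReal hL.le]

end Space

namespace Space

open FinslerPL.Complex

variable {X : Type u} [EMetricSpace X] {S : Space.{u, v, w} X} {γ : ℝ → X}

/-! ### Geodesics have unit speed parameterizations -/

/-- Broken lines, run through at one segment per unit of time, are competitors for shortest paths;
hence a shortest path has length equal to the distance of its ends. -/
lemma exists_curve_of_edist_lt (S : Space.{u, v, w} X) {x y : X} {L : ℝ≥0∞} (h : edist x y < L) :
    ∃ (d : ℝ) (σ : ℝ → X), 0 ≤ d ∧ ContinuousOn σ (Icc 0 d) ∧ σ 0 = x ∧ σ d = y ∧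
      len σ 0 d ≤ L := by
  rw [S.edist_eq] at h
  refine chain_induction (C := fun z L => ∃ (d : ℝ) (σ : ℝ → X), 0 ≤ d ∧
    ContinuousOn σ (Icc 0 d) ∧ σ 0 = x ∧ σ d = z ∧ len σ 0 d ≤ L) ?_ ?_ ?_ h
  · intro L _
    exact ⟨0, fun _ => x, le_rfl, continuousOn_const, rfl, rfl, by simp [len]⟩
  · rintro i p q L hp hq ⟨d, σ, hd, hσ, h0, h1, hlen⟩
    set τ : ℝ → X := fun t => if t ≤ d then σ t else S.proj i (AffineMap.lineMap p q (t - d))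
    have e1 : EqOn τ σ (Icc 0 d) := fun t ht => if_pos ht.2
    have e2 : EqOn τ (fun t => S.proj i (AffineMap.lineMap p q (t - d))) (Icc d (d + 1)) := by
      intro t ht
      rcases ht.1.eq_or_lt with rfl | hlt
      · simp [τ, h1]
      · exact if_neg (not_le.2 hlt)
    have hlip : LipschitzOnWith (nndist p q)
        (fun t => S.proj i (AffineMap.lineMap p q (t - d))) (Icc d (d + 1)) := by
      intro s hs t ht
      refine (edist_proj_le (lineMap_mem_cell hp hq ⟨by linarith [hs.1], by linarith [hs.2]⟩)
        (lineMap_mem_cell hp hq ⟨by linarith [ht.1], by linarith [ht.2]⟩)).trans ?_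
      rw [edist_dist, dist_lineMap_lineMap, edist_dist, dist_sub_right, mul_comm,
        ENNReal.ofReal_mul dist_nonneg, ← edist_dist, edist_nndist]
    refine ⟨d + 1, τ, by linarith, ?_, by rw [e1 ⟨le_rfl, hd⟩, h0], by
      rw [e2 ⟨by linarith, le_rfl⟩]; simp, ?_⟩
    · rw [← Icc_union_Icc_eq_Icc hd (by linarith : d ≤ d + 1)]
      exact (hσ.congr e1).union_of_isClosed (hlip.continuousOn.congr e2) isClosed_Icc isClosed_Icc
    · rw [← len_add hd (by linarith : d ≤ d + 1)]
      refine add_le_add (by rwa [len, eVariationOn.eq_of_eqOn e1]) ?_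
      rw [len, eVariationOn.eq_of_eqOn e2]
      refine (hlip.comp_eVariationOn_le (g := fun t : ℝ => t) (mapsTo_id _)).trans ?_
      have := monotone_id.monotoneOn (Icc d (d + 1)) |>.eVariationOn_eq
        (a := d) (b := d + 1) ⟨le_rfl, by linarith⟩ ⟨by linarith, le_rfl⟩ |>.le
      rw [inter_self] at this
      calc (nndist p q : ℝ≥0∞) * eVariationOn (fun t : ℝ => t) (Icc d (d + 1))
          ≤ nndist p q * ENNReal.ofReal (d + 1 - d) := by gcongr; exact this
        _ = edist p q := by rw [edist_nndist]; simp
  · rintro z L L' hL ⟨d, σ, h1, h2, h3, h4, h5⟩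
    exact ⟨d, σ, h1, h2, h3, h4, h5.trans hL⟩

lemma edist_ne_top_of_continuousOn {a b : ℝ} (hγ : ContinuousOn γ (Icc a b)) :
    ∀ t ∈ Icc a b, edist (γ a) (γ t) ≠ ⊤ := by
  refine real_induction fun t ht ih => ?_
  obtain ⟨η, hη, h⟩ := exists_delta_of_continuousOn hγ ht one_pos
  have key : edist (γ a) (γ t) ≠ ⊤ := by
    rcases ht.1.eq_or_lt with rfl | hat
    · simp
    obtain ⟨s, h1, h2⟩ := exists_between (max_lt hat (sub_lt_self t hη))
    rw [max_lt_iff] at h1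
    have h3 := h s ⟨h1.1.le, h2.le.trans ht.2⟩ (by rw [abs_lt]; constructor <;> linarith)
    rw [edist_comm] at h3
    exact ((edist_triangle _ (γ s) _).trans_lt
      (ENNReal.add_lt_top.2 ⟨(ih s ⟨h1.1.le, h2⟩).lt_top, h3.trans ENNReal.ofReal_lt_top⟩)).ne
  refine ⟨η, hη, fun s hs hts hlt => ?_⟩
  have h3 := h s hs (by rw [abs_of_nonneg (sub_nonneg.2 hts)]; linarith)
  exact ((edist_triangle _ (γ t) _).trans_lt
    (ENNReal.add_lt_top.2 ⟨key.lt_top, h3.trans ENNReal.ofReal_lt_top⟩)).ne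

lemma len_le_edist_of_isShortestPath (S : Space.{u, v, w} X) {s t : ℝ}
    (h : IsShortestPath γ s t) : len γ s t ≤ edist (γ s) (γ t) := by
  refine le_of_forall_gt_imp_ge_of_dense fun L hL => ?_
  obtain ⟨d, σ, h1, h2, h3, h4, h5⟩ := S.exists_curve_of_edist_lt hL
  exact (h.2 0 d σ h1 h2 h3 h4).trans h5

lemma exists_edist_eq_len (S : Space.{u, v, w} X) {a b : ℝ} (hγ : IsGeodesic γ a b) {t₀ : ℝ}
    (ht₀ : t₀ ∈ Icc a b) :
    ∃ η > 0, ∀ s ∈ Icc a b, ∀ t ∈ Icc a b, s ≤ t → |s - t₀| < η → |t - t₀| < η →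
      edist (γ s) (γ t) = len γ s t ∧ len γ s t ≠ ⊤ := by
  obtain ⟨c, d, hcd, -, hnhds, hsp⟩ := hγ.2 t₀ ht₀
  obtain ⟨η, hη, h⟩ := Metric.mem_nhdsWithin_iff.1 hnhds
  refine ⟨η, hη, fun s hs t ht hst hsη htη => ?_⟩
  have hs' : s ∈ Icc c d := h ⟨hsη, hs⟩
  have ht' : t ∈ Icc c d := h ⟨htη, ht⟩
  have hfin := edist_ne_top_of_continuousOn hsp.1 d ⟨hcd, le_rfl⟩
  have hle := S.len_le_edist_of_isShortestPath hsp
  refine ⟨edist_eq_len_of_len_le hle hfin hs'.1 hst ht'.2, ?_⟩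
  exact ((len_mono hs'.1 ht'.2).trans_lt (hle.trans_lt hfin.lt_top)).ne

lemma len_ne_top_of_isGeodesic (S : Space.{u, v, w} X) {a b : ℝ} (hγ : IsGeodesic γ a b) :
    ∀ t ∈ Icc a b, len γ a t ≠ ⊤ := by
  refine real_induction fun t ht ih => ?_
  obtain ⟨η, hη, h⟩ := S.exists_edist_eq_len hγ ht
  have key : len γ a t ≠ ⊤ := by
    rcases ht.1.eq_or_lt with rfl | hat
    · simp [len]
    obtain ⟨s, h1, h2⟩ := exists_between (max_lt hat (sub_lt_self t hη))
    rw [max_lt_iff] at h1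
    rw [← len_add h1.1.le h2.le]
    exact ENNReal.add_ne_top.2 ⟨ih s ⟨h1.1.le, h2⟩, (h s ⟨h1.1.le, h2.le.trans ht.2⟩ t ht h2.le
      (by rw [abs_lt]; constructor <;> linarith) (by simpa using hη)).2⟩
  refine ⟨η, hη, fun s hs hts hlt => ?_⟩
  rw [← len_add ht.1 hts]
  exact ENNReal.add_ne_top.2 ⟨key, (h t ht s hs hts (by simpa using hη)
    (by rw [abs_of_nonneg (sub_nonneg.2 hts)]; linarith)).2⟩

/-- A strictly increasing continuous map of intervals has an increasing continuous inverse. -/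
lemma exists_inverse {φ : ℝ → ℝ} {a b : ℝ} (hab : a ≤ b) (hφ : StrictMonoOn φ (Icc a b))
    (hc : ContinuousOn φ (Icc a b)) :
    ∃ ψ : ℝ → ℝ, ContinuousOn ψ (Icc (φ a) (φ b)) ∧ MonotoneOn ψ (Icc (φ a) (φ b)) ∧
      MapsTo ψ (Icc (φ a) (φ b)) (Icc a b) ∧ (∀ y ∈ Icc (φ a) (φ b), φ (ψ y) = y) ∧
      ∀ t ∈ Icc a b, φ t ∈ Icc (φ a) (φ b) ∧ ψ (φ t) = t := by
  have hsurj : ∀ y ∈ Icc (φ a) (φ b), ∃ t ∈ Icc a b, φ t = y := fun y hy =>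
    intermediate_value_Icc hab hc hy
  have ha : a ∈ Icc a b := ⟨le_rfl, hab⟩
  have hb : b ∈ Icc a b := ⟨hab, le_rfl⟩
  set ψ := Function.invFunOn φ (Icc a b)
  have h1 : MapsTo ψ (Icc (φ a) (φ b)) (Icc a b) := fun y hy =>
    Function.invFunOn_mem (hsurj y hy)
  have h2 : ∀ y ∈ Icc (φ a) (φ b), φ (ψ y) = y := fun y hy => Function.invFunOn_eq (hsurj y hy)
  have h3 : ∀ t ∈ Icc a b, φ t ∈ Icc (φ a) (φ b) := fun t ht =>
    ⟨hφ.monotoneOn ha ht ht.1, hφ.monotoneOn ht hb ht.2⟩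
  have h4 : ∀ t ∈ Icc a b, ψ (φ t) = t := fun t ht =>
    hφ.injOn (h1 (h3 t ht)) ht (h2 _ (h3 t ht))
  refine ⟨ψ, ?_, fun y hy z hz hyz => ?_, h1, h2, fun t ht => ⟨h3 t ht, h4 t ht⟩⟩
  -- The preimage of a closed set under `ψ` is the image under `φ` of a compact set.
  · rw [continuousOn_iff_isClosed]
    intro C hC
    refine ⟨φ '' (Icc a b ∩ C), ((isCompact_Icc.inter_right hC).image_of_continuousOn
      (hc.mono inter_subset_left)).isClosed, ?_⟩
    ext y
    constructor
    · rintro ⟨hyC, hy⟩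
      exact ⟨⟨ψ y, ⟨h1 hy, hyC⟩, h2 y hy⟩, hy⟩
    · rintro ⟨⟨t, ⟨ht, htC⟩, rfl⟩, hy⟩
      exact ⟨by rw [mem_preimage, h4 t ht]; exact htC, hy⟩
  · rw [← hφ.le_iff_le (h1 hy) (h1 hz), h2 y hy, h2 z hz]
    exact hyz

lemma isStable_of_constant {a b : ℝ} (hab : a ≤ b) (h : ∀ t ∈ Icc a b, γ t = γ a) :
    IsStable γ a b := by
  refine ⟨1, one_pos, fun σ hσ ha hb _ hrep => ?_⟩
  have h0 : len γ a b = 0 := by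
    refine eVariationOn.constant_on ?_
    rintro _ ⟨s, hs, rfl⟩ _ ⟨t, ht, rfl⟩
    rw [h s hs, h t ht]
  rw [h0, pos_iff_ne_zero]
  intro hlen
  refine hrep ⟨id, continuousOn_id, monotone_id.monotoneOn _, rfl, rfl, fun t ht => ?_⟩
  rw [id, h t ht, ← ha]
  have := edist_le_len (σ := σ) ht (⟨le_rfl, hab⟩ : a ∈ Icc a b)
  rw [hlen] at this
  exact edist_le_zero.1 this

/-- Arc length `φ` is continuous because `γ` is locally shortest, and strictly increasing because
`γ` never stops. Its inverse `ψ` gives `γ ∘ ψ` unit speed without lengthening the competitor `γ₁ ∘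
ψ`; a reparameterization `θ` found there is conjugated back to `ψ ∘ θ ∘ φ`. -/
lemma isStable_of_noStops (S : Space.{u, v, w} X) {a b : ℝ} (hab : a < b)
    (hγ : IsGeodesic γ a b)
    (hns : ∀ s t : ℝ, a ≤ s → s < t → t ≤ b → ∃ r ∈ Icc s t, γ r ≠ γ s) : IsStable γ a b := by
  have hfin := S.len_ne_top_of_isGeodesic hγ
  set φ : ℝ → ℝ := fun t => (len γ a t).toReal with hφdef
  have hsub : ∀ s t, a ≤ s → s ≤ t → t ≤ b → φ t - φ s = (len γ s t).toReal :=
    fun s t hs hst ht => by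
      simp only [hφdef]
      rw [toReal_len_add hs hst (hfin t ⟨hs.trans hst, ht⟩)]
      ring
  have hfin' : ∀ s t, a ≤ s → s ≤ t → t ≤ b → len γ s t ≠ ⊤ := fun s t hs hst ht =>
    ((len_mono hs le_rfl).trans_lt (hfin t ⟨hs.trans hst, ht⟩).lt_top).ne
  have hφm : StrictMonoOn φ (Icc a b) := fun s hs t ht hst => by
    rw [← sub_pos, hsub s t hs.1 hst.le ht.2]
    refine ENNReal.toReal_pos ?_ (hfin' s t hs.1 hst.le ht.2)
    obtain ⟨r, hr, hne⟩ := hns s t hs.1 hst ht.2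
    exact ((edist_pos.2 hne).trans_le (edist_le_len hr ⟨le_rfl, hst.le⟩)).ne'
  have hloc : ∀ t₀ ∈ Icc a b, ∃ η > 0, ∀ s ∈ Icc a b, ∀ t ∈ Icc a b, |s - t₀| < η →
      |t - t₀| < η → edist (γ s) (γ t) = ENNReal.ofReal |φ s - φ t| := by
    intro t₀ ht₀
    obtain ⟨η, hη, h⟩ := S.exists_edist_eq_len hγ ht₀
    refine ⟨η, hη, fun s hs t ht hsη htη => ?_⟩
    wlog hst : s ≤ t generalizing s t
    · rw [edist_comm, abs_sub_comm]
      exact this t ht s hs htη hsη (le_of_not_ge hst)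
    rw [(h s hs t ht hst hsη htη).1, abs_sub_comm, hsub s t hs.1 hst ht.2,
      abs_of_nonneg ENNReal.toReal_nonneg, ENNReal.ofReal_toReal (hfin' s t hs.1 hst ht.2)]
  have hφc : ContinuousOn φ (Icc a b) := by
    rw [Metric.continuousOn_iff]
    intro t₀ ht₀ ε hε
    obtain ⟨η, hη, h⟩ := hloc t₀ ht₀
    obtain ⟨δ, hδ, h'⟩ := exists_delta_of_continuousOn hγ.1 ht₀ hε
    refine ⟨min η δ, lt_min hη hδ, fun t ht htt => ?_⟩
    have h1 := h' t ht (htt.trans_le (min_le_right _ _))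
    rwa [h t₀ ht₀ t ht (by simpa using hη) (htt.trans_le (min_le_left _ _)),
      ENNReal.ofReal_lt_ofReal_iff hε, abs_sub_comm] at h1
  have ha : a ∈ Icc a b := ⟨le_rfl, hab.le⟩
  have hb : b ∈ Icc a b := ⟨hab.le, le_rfl⟩
  have hφa : φ a = 0 := by simp [hφdef, len]
  obtain ⟨ψ, hψc, hψm, hψmap, hφψ, hψφ⟩ := exists_inverse hab.le hφm hφc
  rw [hφa] at hψc hψm hψmap hφψ hψφ
  set L := φ b with hL
  have hL0 : 0 < L := hφa ▸ hφm ha hb hab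
  have hψ0 : ψ 0 = a := by rw [← hφa]; exact (hψφ a ha).2
  have hψL : ψ L = b := (hψφ b hb).2
  obtain ⟨ε, hε, hstab⟩ := exists_stable_of_unitSpeed (γ := γ ∘ ψ) S hL0 (fun c hc => by
    obtain ⟨η, hη, h⟩ := hloc (ψ c) (hψmap hc)
    obtain ⟨δ, hδ, h'⟩ := Metric.continuousOn_iff.1 hψc c hc η hη
    refine ⟨δ, hδ, fun s hs t ht hsδ htδ => ?_⟩
    rw [Function.comp, Function.comp,
      h _ (hψmap hs) _ (hψmap ht) (h' s hs hsδ) (h' t ht htδ), hφψ s hs, hφψ t ht])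
    (hγ.1.comp hψc hψmap)
  refine ⟨ENNReal.ofReal ε, ENNReal.ofReal_pos.2 hε, fun γ₁ hγ₁ h1a h1b hclose hrep => ?_⟩
  by_contra hlen
  rw [not_lt] at hlen
  obtain ⟨θ, hθc, hθm, hθ0, hθL, hθ⟩ := hstab (γ₁ ∘ ψ) (hγ₁.comp hψc hψmap)
    (by simp [hψ0, h1a]) (by simp [hψL, h1b])
    (fun τ hτ => by rw [edist_comm]; exact hclose _ (hψmap hτ))
    (by
      refine (eVariationOn.comp_le_of_monotoneOn γ₁ ψ hψm hψmap).trans (hlen.trans ?_)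
      rw [hL, ENNReal.ofReal_toReal (hfin b hb)])
  have hθmap : MapsTo θ (Icc 0 L) (Icc 0 L) := fun y hy =>
    ⟨hθ0 ▸ hθm ⟨le_rfl, hL0.le⟩ hy hy.1, (hθm hy ⟨hL0.le, le_rfl⟩ hy.2).trans hθL.le⟩
  have hφmap : MapsTo φ (Icc a b) (Icc 0 L) := fun t ht => (hψφ t ht).1
  refine hrep ⟨ψ ∘ θ ∘ φ, hψc.comp (hθc.comp hφc hφmap) (hθmap.comp hφmap),
    hψm.comp (hθm.comp hφm.monotoneOn hφmap) (hθmap.comp hφmap), ?_, ?_, fun t ht => ?_⟩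
  · simp [hφa, hθ0, hψ0]
  · simp [← hL, hθL, hψL]
  · have := hθ (φ t) (hφmap ht)
    rwa [Function.comp, (hψφ t ht).2] at this

end Space

end FinslerPL

theorem mainTheorem2 {X : Type u} [EMetricSpace X] (S : FinslerPL.Space.{u, v, w} X)
    (a b : ℝ) (hab : a ≤ b) (γ : ℝ → X)
    (hγ : FinslerPL.IsGeodesic γ a b) (hns : FinslerPL.NoStops γ a b) :
    FinslerPL.IsStable γ a b := by
  rcases hab.eq_or_lt with rfl | hlt
  · exact FinslerPL.Space.isStable_of_constant le_rfl fun t ht => by rw [le_antisymm ht.2 ht.1]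
  rcases hns with h | h
  · exact FinslerPL.Space.isStable_of_constant hab h
  · exact S.isStable_of_noStops hlt hγ h
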